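/- Let $1\le m\le n$, $T\ge 1$, and let $\mathcal X$ be the set of matrices $X\in\{0,1\}^{n\times m}$ with $\sum_i X_{i,j}=1$ for all $j$ and $\sum_j X_{i,j}\le 1$ for all $i$. Let $\alpha_1,\dots,\alpha_n\in[0,1]$ and $\beta_1,\dots,\beta_m\in(0,1]$ satisfy $\alpha_1>\dots>\alpha_m>\alpha_{m+1}\ge\dots\ge\alpha_n$ (if $m=n$: $\alpha_1>\dots>\alpha_n$) and $\beta_1>\dots>\beta_m>\beta_{m+1}:=0$. In the stochastic position-based model, given the history $(\ell_1,X_1,\dots,\ell_{t-1},X_{t-1})$, the entries of the loss matrix $\ell_t\in\{0,1\}^{n\times m}$ are independent with $\ell_{t,i,j}\sim\mathrm{Ber}(1-\alpha_i\beta_j)$. The algorithm FTRL-PBM starts from $\hat L_0=0$ and in round $t=1,\dots,T$ computes $$x_t=\operatorname*{arg\,min}_{x\in\mathrm{Conv}(\mathcal X)}\ \langle x,\hat L_{t-1}\rangle-2\sqrt t\,\sum_{i,j}\sqrt{x_{i,j}},$$ draws $X_t\in\mathcal X$, conditionally on the history and on $\ell_t$, from a distribution $P(x_t)$ (where $x\mapsto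 P(x)$ is any fixed sampling rule such that $P(x)$ has mean $x$ for every $x\in\mathrm{Conv}(\mathcal X)$), and sets $\hat L_t=\hat L_{t-1}+\hat\ell_t$ with $\hat\ell_{t,i,j}=\ell_{t,i,j}\mathbf 1\{X_{t,i,j}=1\}/x_{t,i,j}$. Let $R(T)=\mathbb E\big[\sum_{t=1}^T\langle X_t-x^*,\ell_t\rangle\big]$, where $x^*\in\arg\min_{x\in\mathcal X}\mathbb E\big[\sum_{t=1}^T\langle x,\ell_t\rangle\big]$. For $i\in[n]$, $j\in[m]$ put $$\Delta_{i,j}=\begin{cases}(\beta_j-\beta_{j+1})(\alpha_j-\alpha_i)& j<i,\\ 0& j=i,\\ (\beta_{j-1}-\beta_j)(\alpha_i-\alpha_j)& j>i.\end{cases}$$ Then $$R(T)\le\Big(18\sum_{j=1}^m\sum_{\substack{i=1\\ i\neq j}}^n\frac1{\Delta_{i,j}}+4m\Big)\log T+6m .$$ Moreover, there is a universal constant $C>0$ such that, whenever $n\ge 2$ and $T\ge 2$, the right-hand side is at most $C\,\frac{mn}{\Delta_\beta\Delta}\log T$, where $\Delta=\min\{\alpha_i-\alpha_{i+1}: 1\le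 i\le m,\ i+1\le n\}$ and $\Delta_\beta=\min_{1\le j\le m}(\beta_j-\beta_{j+1})$. -/

import Mathlib

open MeasureTheory

/-- A stochastic position-based model with `n` items and `m` positions. Items and positions are
indexed from `0`, so that the item with index `i` is the item `i + 1` of the usual numbering.
`alpha_lt` and `alpha_anti` say `α₁ > ⋯ > α_m > α_{m+1} ≥ ⋯ ≥ α_n` (if `m = n` there is no item
`m + 1` and the condition reads `α₁ > ⋯ > α_n`). -/
structure PBM (n m : ℕ) where
  one_le : 1 ≤ m
  le : m ≤ n
  /-- attractiveness of the items -/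
  α : Fin n → ℝ
  /-- examination probability of the positions -/
  β : Fin m → ℝ
  alpha_nonneg : ∀ i, 0 ≤ α i
  alpha_le_one : ∀ i, α i ≤ 1
  beta_pos : ∀ j, 0 < β j
  beta_le_one : ∀ j, β j ≤ 1
  alpha_anti : Antitone α
  alpha_lt : ∀ i k : Fin n, i < k → (i : ℕ) < m → α k < α i
  beta_anti : StrictAnti β

namespace PBM

noncomputable section

/-- The inner product `⟨x, y⟩ = ∑ᵢ ∑ⱼ xᵢⱼ yᵢⱼ` of matrices. -/
def dot {n m : ℕ} (x y : Matrix (Fin n) (Fin m) ℝ) : ℝ := ∑ i, ∑ j, x i j * y i j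

/-- The action set `𝒳` of subpermutation matrices. -/
def actionSet (n m : ℕ) : Set (Matrix (Fin n) (Fin m) ℝ) :=
  {x | (∀ i j, x i j = 0 ∨ x i j = 1) ∧ (∀ j, ∑ i, x i j = 1) ∧ ∀ i, ∑ j, x i j ≤ 1}

/-- The subpermutation matrix of an ordered list of `m` distinct items: its `(i, j)` entry is `1`
if item `i` is placed at position `j`, and `0` otherwise. -/
def listMatrix {n m : ℕ} (I : Fin m ↪ Fin n) : Matrix (Fin n) (Fin m) ℝ :=
  fun i j => if I j = i then 1 else 0

/-- Ordered lists of `m` distinct items are the same thing as subpermutation matrices. -/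
theorem range_listMatrix (n m : ℕ) :
    Set.range (listMatrix : (Fin m ↪ Fin n) → Matrix (Fin n) (Fin m) ℝ) = actionSet n m := by
  ext x
  constructor
  · rintro ⟨I, rfl⟩
    refine ⟨fun i j => ?_, fun j => ?_, fun i => ?_⟩
    · unfold listMatrix; split_ifs <;> simp
    · simp [listMatrix]
    · by_cases h : ∃ j, I j = i
      · obtain ⟨j, rfl⟩ := h
        simp [listMatrix]
      · push Not at h
        simp [listMatrix, h]
  · rintro ⟨h01, hc, hr⟩
    have hnn : ∀ i j, 0 ≤ x i j := fun i j => by rcases h01 i j with h | h <;> simp [h]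
    have hex : ∀ j, ∃ i, x i j = 1 := fun j => by
      by_contra! h
      have : ∑ i, x i j = 0 := Finset.sum_eq_zero fun i _ => (h01 i j).resolve_right (h i)
      rw [hc j] at this
      norm_num at this
    choose f hf using hex
    have hinj : Function.Injective f := fun j k hjk => by
      by_contra hne
      have h2 : ∑ l ∈ ({j, k} : Finset (Fin m)), x (f j) l ≤ ∑ l, x (f j) l :=
        Finset.sum_le_sum_of_subset_of_nonneg (Finset.subset_univ _) fun l _ _ => hnn _ _
      rw [Finset.sum_pair hne, hf j] at h2
      have h3 := hf k
      rw [← hjk] at h3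
      have := hr (f j)
      linarith
    refine ⟨⟨f, hinj⟩, ?_⟩
    ext i j
    simp only [listMatrix, Function.Embedding.coeFn_mk]
    split_ifs with h
    · rw [← h, hf]
    · refine ((h01 i j).resolve_right fun h1 => ?_).symm
      have h2 : ∑ l ∈ ({i, f j} : Finset (Fin n)), x l j ≤ ∑ l, x l j :=
        Finset.sum_le_sum_of_subset_of_nonneg (Finset.subset_univ _) fun l _ _ => hnn _ _
      rw [Finset.sum_pair (Ne.symm h), hf j, h1, hc j] at h2
      linarith

/-- The real loss matrix of a matrix with entries in `{0, 1}`, written with Booleans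
(`true` is loss `1`, that is no click). -/
def lossMatrix {n m : ℕ} (M : Fin n → Fin m → Bool) : Matrix (Fin n) (Fin m) ℝ :=
  fun i j => if M i j then 1 else 0

/-! ### The suboptimality gaps -/

/-- Examination probability of the position with (zero-based) index `k`, continued by
`β_{m+1} = 0`. -/
def betaExt {n m : ℕ} (V : PBM n m) (k : ℕ) : ℝ := if h : k < m then V.β ⟨k, h⟩ else 0

/-- The suboptimality gap `Δᵢⱼ` of item `i` at position `j`. -/
def gap {n m : ℕ} (V : PBM n m) (i : Fin n) (j : Fin m) : ℝ :=
  if (j : ℕ) < i then (V.betaExt j - V.betaExt (j + 1)) * (V.α (Fin.castLE V.le j) - V.α i)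
  else if (j : ℕ) = i then 0
  else (V.betaExt (j - 1) - V.betaExt j) * (V.α i - V.α (Fin.castLE V.le j))

/-- `Δ`, the least of the differences `αᵢ - αᵢ₊₁` with `i` among the first `m` items and `i + 1`
an item. -/
def gapAlpha {n m : ℕ} (V : PBM n m) : ℝ :=
  ⨅ i : {i : Fin m // (i : ℕ) + 1 < n}, V.α (Fin.castLE V.le i.1) - V.α ⟨(i.1 : ℕ) + 1, i.2⟩

/-- `Δ_β`, the least of the differences `βⱼ - βⱼ₊₁` over the `m` positions, with `β_{m+1} = 0`. -/
def gapBeta {n m : ℕ} (V : PBM n m) : ℝ := ⨅ j : Fin m, V.betaExt j - V.betaExt (j + 1)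

/-! ### The algorithm -/

/-- The regularizer (`1/2`-Tsallis entropy). -/
def tsallis {n m : ℕ} (x : Matrix (Fin n) (Fin m) ℝ) : ℝ := ∑ i, ∑ j, -√(x i j)

/-- The learning rate of round `t`. -/
def learningRate (t : ℕ) : ℝ := 1 / (2 * √(t : ℝ))

/-- `x` minimizes `⟨x, L⟩ + Ψ(x) / η_t` over `Conv(𝒳)`. -/
def IsLeader {n m : ℕ} (t : ℕ) (L x : Matrix (Fin n) (Fin m) ℝ) : Prop :=
  x ∈ convexHull ℝ (actionSet n m) ∧
    IsMinOn (fun y => dot y L + 1 / learningRate t * tsallis y) (convexHull ℝ (actionSet n m)) x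

/-- The regularized leader of round `t` for the cumulative estimated loss `L`. -/
def leader {n m : ℕ} (t : ℕ) (L : Matrix (Fin n) (Fin m) ℝ) : Matrix (Fin n) (Fin m) ℝ :=
  Classical.epsilon (IsLeader t L)

theorem leader_spec {n m : ℕ} (hmn : m ≤ n) (t : ℕ) (L : Matrix (Fin n) (Fin m) ℝ) :
    IsLeader t L (leader t L) := by
  refine Classical.epsilon_spec (p := IsLeader t L) ?_
  have hfin : (actionSet n m).Finite := by
    rw [← range_listMatrix]
    exact Set.finite_range _
  have hne : (convexHull ℝ (actionSet n m)).Nonempty := by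
    rw [convexHull_nonempty_iff, ← range_listMatrix]
    exact ⟨_, Fin.castLEEmb hmn, rfl⟩
  have hcont : Continuous fun y : Matrix (Fin n) (Fin m) ℝ =>
      dot y L + 1 / learningRate t * tsallis y := by
    unfold dot tsallis
    fun_prop
  exact (hfin.isCompact_convexHull (𝕜 := ℝ)).exists_isMinOn hne hcont.continuousOn

/-- The cumulative estimated loss `L̂_t` after `t` rounds in which the loss matrices are
`M 1, …, M t` and the selected lists are `A 1, …, A t`. Only the entries of the loss matrices that
the selected lists reveal enter. -/
def cumLoss {n m : ℕ} (M : ℕ → Fin n → Fin m → Bool) (A : ℕ → Fin m ↪ Fin n) :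
    ℕ → Matrix (Fin n) (Fin m) ℝ
  | 0 => 0
  | t + 1 => fun i j => cumLoss M A t i j +
      lossMatrix (M (t + 1)) i j * listMatrix (A (t + 1)) i j / leader (t + 1) (cumLoss M A t) i j

/-- The regularized leader `x_t` after the rounds `1, …, t - 1` went as described by `M` and `A`. -/
def iterate {n m : ℕ} (M : ℕ → Fin n → Fin m → Bool) (A : ℕ → Fin m ↪ Fin n) (t : ℕ) :
    Matrix (Fin n) (Fin m) ℝ :=
  leader t (cumLoss M A (t - 1))

/-- A sampling rule `x ↦ P(x)`: a distribution on the actions for every `x`, with mean `x` for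
every `x` in `Conv(𝒳)`. -/
def IsSamplingRule {n m : ℕ} (P : Matrix (Fin n) (Fin m) ℝ → PMF (Fin m ↪ Fin n)) : Prop :=
  ∀ x ∈ convexHull ℝ (actionSet n m), ∑ I, (P x I).toReal • listMatrix I = x

/-! ### The interaction -/

/-- The event that the rounds `1, …, t` went as described by `M` and `A`. -/
def historyEvent {n m : ℕ} {Ω : Type*} (ell : ℕ → Ω → Fin n → Fin m → Bool)
    (I : ℕ → Ω → Fin m ↪ Fin n) (t : ℕ) (M : ℕ → Fin n → Fin m → Bool)
    (A : ℕ → Fin m ↪ Fin n) : Set Ω :=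
  {ω | ∀ s ∈ Finset.Icc 1 t, ell s ω = M s ∧ I s ω = A s}

/-- Probability that a matrix with independent entries, the `(i, j)` entry being Bernoulli with
parameter `1 - αᵢ βⱼ`, is equal to `M`. -/
def lossProb {n m : ℕ} (V : PBM n m) (M : Fin n → Fin m → Bool) : ℝ :=
  ∏ i, ∏ j, if M i j then 1 - V.α i * V.β j else V.α i * V.β j

/-- The loss matrices `ell 1, …, ell T` and the selected lists `I 1, …, I T` are random variables
on `(Ω, μ)` that come from running the algorithm with sampling rule `P` for `T` rounds in the
stochastic environment `V`. In each round `t`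
* given the history of the rounds `1, …, t - 1`, the entries of the loss matrix are independent
  and Bernoulli with parameters `1 - αᵢ βⱼ`;
* given that history and the loss matrix of the round, the list is drawn from `P(x_t)`.
Losses and lists take finitely many values, so conditional laws are written out on the atoms:
`μ (H ∩ E) = μ H * (conditional probability of E given H)`. -/
structure IsRun {n m : ℕ} (V : PBM n m)
    (P : Matrix (Fin n) (Fin m) ℝ → PMF (Fin m ↪ Fin n)) (T : ℕ)
    {Ω : Type*} [MeasurableSpace Ω] (μ : Measure Ω)
    (ell : ℕ → Ω → Fin n → Fin m → Bool) (I : ℕ → Ω → Fin m ↪ Fin n) : Prop where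
  measurable_loss : ∀ t ∈ Finset.Icc 1 T, ∀ N, MeasurableSet {ω | ell t ω = N}
  measurable_list : ∀ t ∈ Finset.Icc 1 T, ∀ a, MeasurableSet {ω | I t ω = a}
  loss_law : ∀ t ∈ Finset.Icc 1 T, ∀ M A,
    μ.real (historyEvent ell I (t - 1) M A ∩ {ω | ell t ω = M t}) =
      μ.real (historyEvent ell I (t - 1) M A) * V.lossProb (M t)
  list_law : ∀ t ∈ Finset.Icc 1 T, ∀ M A,
    μ.real (historyEvent ell I (t - 1) M A ∩ {ω | ell t ω = M t} ∩ {ω | I t ω = A t}) =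
      μ.real (historyEvent ell I (t - 1) M A ∩ {ω | ell t ω = M t}) *
        (P (iterate M A t) (A t)).toReal

/-- `x ∈ 𝒳` minimizes the expected cumulative loss `𝔼[∑_{t ≤ T} ⟨x, ℓ_t⟩]`. -/
def IsBestAction {n m : ℕ} {Ω : Type*} [MeasurableSpace Ω] (μ : Measure Ω)
    (ell : ℕ → Ω → Fin n → Fin m → Bool) (T : ℕ) (x : Matrix (Fin n) (Fin m) ℝ) : Prop :=
  x ∈ actionSet n m ∧
    IsMinOn (fun y => ∫ ω, ∑ t ∈ Finset.Icc 1 T, dot y (lossMatrix (ell t ω)) ∂μ)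
      (actionSet n m) x

/-- The expected cumulative regret `𝔼[∑_{t ≤ T} ⟨X_t - x, ℓ_t⟩]` against the action `x`. -/
def regret {n m : ℕ} {Ω : Type*} [MeasurableSpace Ω] (μ : Measure Ω)
    (ell : ℕ → Ω → Fin n → Fin m → Bool) (I : ℕ → Ω → Fin m ↪ Fin n) (T : ℕ)
    (x : Matrix (Fin n) (Fin m) ℝ) : ℝ :=
  ∫ ω, ∑ t ∈ Finset.Icc 1 T, dot (listMatrix (I t ω) - x) (lossMatrix (ell t ω)) ∂μ

end

end PBM

/-!
The proof is the self-bounding analysis of follow-the-regularized-leader with the `1/2`-Tsallis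
entropy.

Let `r x = ⟨x - best, 𝔼 ℓ⟩` be the instantaneous regret of `x ∈ Conv(𝒳)`, where `best` puts item `j`
at position `j`. Summation by parts in `β` writes `r x` as a nonnegative combination of the
attractiveness lost on the prefixes of the list, and gives `r x ≥ ½ ∑ Δᵢⱼ xᵢⱼ`
(`half_sum_gap_le`). In particular `best` is an optimal action.

The leaders have positive entries, because the regularizer has infinite slope at the boundary; hence
the importance-weighted estimates are unbiased, and the first-order condition gives a Bregman
inequality (`IsLeader.bregman`). On every trajectory the estimated regret is therefore at most a sum
of stability and penalty terms (`estimated_regret_le`). In the stability term the estimates of each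
column are shifted by the loss of the item played there, which costs nothing because column sums are
fixed, and after taking expectations leaves `√x (1 - x) / √t` per entry and a term `2 m / t`
(`condMean_stabBound_le`). All expectations are taken round by round over the finitely many
histories (`IsRun.integral_round`).

In stability plus penalty the diagonal entries are eliminated through `1 - xⱼⱼ = ∑_{i ≠ j} xᵢⱼ`,
which leaves about `(5/2) ∑_{i ≠ j} √xᵢⱼ / √t`. Writing the regret as `2 R - R`, bounding the first
copy by these terms and the second from below by `½ ∑ Δᵢⱼ xᵢⱼ`, and maximizing over each entry gives
`(25/2) / (t Δᵢⱼ)` per round and entry (`two_roundBound_sub_le`). The sum over the rounds has the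
constant `25/2 < 18` in front of `log T`, and the difference absorbs all further terms once
`T ≥ 21`; for smaller `T` trivial bounds on the regret suffice (`IsRun.regret_best_le_main`).
-/

open MeasureTheory

namespace PBM

noncomputable section

/-! ### The convex hull of the actions -/

theorem nonneg_of_mem_hull {n m : ℕ} {x : Matrix (Fin n) (Fin m) ℝ}
    (hx : x ∈ convexHull ℝ (actionSet n m)) (i : Fin n) (j : Fin m) : 0 ≤ x i j := by
  have hconv : Convex ℝ {x : Matrix (Fin n) (Fin m) ℝ | 0 ≤ x i j} := by
    intro a ha b hb s t hs ht _
    exact add_nonneg (mul_nonneg hs ha) (mul_nonneg ht hb)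
  refine convexHull_min (fun y hy => ?_) hconv hx
  rcases hy.1 i j with h | h <;> simp [h]

theorem colSum_of_mem_hull {n m : ℕ} {x : Matrix (Fin n) (Fin m) ℝ}
    (hx : x ∈ convexHull ℝ (actionSet n m)) (j : Fin m) : ∑ i, x i j = 1 := by
  have hconv : Convex ℝ {x : Matrix (Fin n) (Fin m) ℝ | ∑ i, x i j = 1} := by
    intro a ha b hb s t _ _ hst
    simp only [Set.mem_ofPred_eq] at ha hb
    simp [Finset.sum_add_distrib, ← Finset.mul_sum, ha, hb, hst]
  exact convexHull_min (fun y hy => hy.2.1 j) hconv hx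

theorem rowSum_of_mem_hull {n m : ℕ} {x : Matrix (Fin n) (Fin m) ℝ}
    (hx : x ∈ convexHull ℝ (actionSet n m)) (i : Fin n) : ∑ j, x i j ≤ 1 := by
  have hconv : Convex ℝ {x : Matrix (Fin n) (Fin m) ℝ | ∑ j, x i j ≤ 1} := by
    intro a ha b hb s t hs ht hst
    simp only [Set.mem_ofPred_eq] at ha hb
    simp only [Set.mem_ofPred_eq, Matrix.add_apply, Matrix.smul_apply, smul_eq_mul,
      Finset.sum_add_distrib, ← Finset.mul_sum]
    nlinarith
  exact convexHull_min (fun y hy => hy.2.2 i) hconv hx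

theorem le_one_of_mem_hull {n m : ℕ} {x : Matrix (Fin n) (Fin m) ℝ}
    (hx : x ∈ convexHull ℝ (actionSet n m)) (i : Fin n) (j : Fin m) : x i j ≤ 1 := by
  rw [← colSum_of_mem_hull hx j]
  exact Finset.single_le_sum (f := fun i => x i j) (fun k _ => nonneg_of_mem_hull hx k j)
    (Finset.mem_univ i)

theorem listMatrix_mem_actionSet {n m : ℕ} (I : Fin m ↪ Fin n) :
    listMatrix I ∈ actionSet n m := by
  rw [← range_listMatrix]
  exact ⟨I, rfl⟩

theorem listMatrix_mem_hull {n m : ℕ} (I : Fin m ↪ Fin n) :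
    listMatrix I ∈ convexHull ℝ (actionSet n m) :=
  subset_convexHull ℝ _ (listMatrix_mem_actionSet I)

/-- The average of the `n` cyclic shifts of the list `1, …, m` has all its entries equal
to `1 / n`. -/
theorem uniform_mem_hull {n m : ℕ} (hn : 0 < n) (hmn : m ≤ n) :
    (Matrix.of fun _ _ => 1 / (n : ℝ) : Matrix (Fin n) (Fin m) ℝ) ∈ convexHull ℝ (actionSet n m) := by
  have : NeZero n := ⟨hn.ne'⟩
  have hn' : (n : ℝ) ≠ 0 := by positivity
  have hmem := (convex_convexHull ℝ (actionSet n m)).sum_mem (t := Finset.univ)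
    (w := fun _ : Fin n => 1 / (n : ℝ))
    (z := fun k => listMatrix ((Fin.castLEEmb hmn).trans (Equiv.addRight k).toEmbedding))
    (fun _ _ => by positivity) (by simp [hn'])
    (fun k _ => listMatrix_mem_hull _)
  refine (congrArg (· ∈ convexHull ℝ (actionSet n m)) ?_).mpr hmem
  ext i j
  rw [Matrix.sum_apply]
  have hiff : ∀ k : Fin n, (Fin.castLE hmn j + k = i) ↔ (k = i - Fin.castLE hmn j) := fun k => by
    rw [eq_sub_iff_add_eq, add_comm]
  simp [listMatrix, hiff]

/-! ### The suboptimality gaps -/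

/-- The optimal action, which puts item `j` at position `j`. -/
def best {n m : ℕ} (V : PBM n m) : Matrix (Fin n) (Fin m) ℝ := listMatrix (Fin.castLEEmb V.le)

/-- The mean of the loss matrices. -/
def meanLoss {n m : ℕ} (V : PBM n m) : Matrix (Fin n) (Fin m) ℝ := fun i j => 1 - V.α i * V.β j

theorem best_mem_hull {n m : ℕ} (V : PBM n m) : V.best ∈ convexHull ℝ (actionSet n m) :=
  listMatrix_mem_hull _

theorem best_apply {n m : ℕ} (V : PBM n m) (i : Fin n) (j : Fin m) :
    V.best i j = if i = Fin.castLE V.le j then 1 else 0 := by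
  simp [best, listMatrix, eq_comm]

theorem betaExt_coe {n m : ℕ} (V : PBM n m) (j : Fin m) : V.betaExt j = V.β j := by
  simp [betaExt]

theorem betaExt_succ_lt {n m : ℕ} (V : PBM n m) {k : ℕ} (hk : k < m) :
    V.betaExt (k + 1) < V.betaExt k := by
  unfold betaExt
  rw [dif_pos hk]
  split_ifs with h
  · exact V.beta_anti (Fin.mk_lt_mk.2 k.lt_succ_self)
  · exact V.beta_pos _

theorem betaExt_nonneg {n m : ℕ} (V : PBM n m) (k : ℕ) : 0 ≤ V.betaExt k := by
  unfold betaExt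
  split_ifs
  · exact (V.beta_pos _).le
  · exact le_rfl

theorem betaExt_le_one {n m : ℕ} (V : PBM n m) (k : ℕ) : V.betaExt k ≤ 1 := by
  unfold betaExt
  split_ifs
  · exact V.beta_le_one _
  · exact zero_le_one

theorem gap_pos {n m : ℕ} (V : PBM n m) {i : Fin n} {j : Fin m} (hij : i ≠ Fin.castLE V.le j) :
    0 < V.gap i j := by
  have hne : (i : ℕ) ≠ j := fun h => hij (Fin.ext h)
  unfold gap
  split_ifs with h1 h2
  · exact mul_pos (sub_pos.2 (V.betaExt_succ_lt j.2))
      (sub_pos.2 (V.alpha_lt _ _ (Fin.lt_def.2 h1) j.2))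
  · exact absurd h2.symm hne
  · have hlt : (i : ℕ) < j := by omega
    have hb := V.betaExt_succ_lt (k := j - 1) (by omega)
    rw [Nat.sub_add_cancel (by omega)] at hb
    exact mul_pos (sub_pos.2 hb)
      (sub_pos.2 (V.alpha_lt _ _ (Fin.lt_def.2 hlt) (hlt.trans j.2)))

theorem gap_nonneg {n m : ℕ} (V : PBM n m) (i : Fin n) (j : Fin m) : 0 ≤ V.gap i j := by
  by_cases h : i = Fin.castLE V.le j
  · subst h
    simp [gap]
  · exact (V.gap_pos h).le

theorem gap_le_one {n m : ℕ} (V : PBM n m) (i : Fin n) (j : Fin m) : V.gap i j ≤ 1 := by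
  have hα : ∀ k l, V.α k - V.α l ≤ 1 := fun k l => by
    linarith [V.alpha_le_one k, V.alpha_nonneg l]
  have hβ : ∀ k l, V.betaExt k - V.betaExt l ≤ 1 := fun k l => by
    linarith [V.betaExt_le_one k, V.betaExt_nonneg l]
  unfold gap
  split_ifs with h1 h2
  · exact mul_le_one₀ (hβ _ _) (sub_nonneg.2 (V.alpha_anti (Fin.le_def.2 h1.le))) (hα _ _)
  · exact zero_le_one
  · exact mul_le_one₀ (hβ _ _) (sub_nonneg.2 (V.alpha_anti (Fin.le_def.2 (by
      simp only [Fin.val_castLE]; omega)))) (hα _ _)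

/-- Summation by parts: `β` is the sum of its own decrements. -/
theorem beta_eq_sum {n m : ℕ} (V : PBM n m) (j : Fin m) :
    V.β j = ∑ k : Fin m, if j ≤ k then V.betaExt k - V.betaExt (k + 1) else 0 := by
  have h := Fin.sum_univ_eq_sum_range
    (fun k => if (j : ℕ) ≤ k then V.betaExt k - V.betaExt (k + 1) else 0) m
  simp only [Fin.le_def]
  rw [h, ← Finset.sum_filter]
  have hf : (Finset.range m).filter (fun k => (j : ℕ) ≤ k) = Finset.Ico (j : ℕ) m := by
    ext k; simp [and_comm]
  rw [hf]
  have ht : ∀ N, (j : ℕ) ≤ N → ∑ k ∈ Finset.Ico (j : ℕ) N, (V.betaExt k - V.betaExt (k + 1)) =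
      V.betaExt j - V.betaExt N := fun N hN => by
    induction N, hN using Nat.le_induction with
    | base => simp
    | succ N hN ih => rw [Finset.sum_Ico_succ_top hN, ih]; ring
  rw [ht m j.2.le, betaExt_coe]
  simp [betaExt]

theorem sum_fin_shift {m : ℕ} (G : Fin m → ℝ) :
    ∑ k : Fin m, (if h : (k : ℕ) + 1 < m then G ⟨k + 1, h⟩ else 0) =
      ∑ j : Fin m, if (j : ℕ) = 0 then 0 else G j := by
  cases m with
  | zero => simp
  | succ m =>
    rw [Fin.sum_univ_castSucc, Fin.sum_univ_succ]
    simp [Fin.succ]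

/-- The attractiveness lost on the first `k + 1` positions by playing `x` instead of the optimal
action. -/
def prefixLoss {n m : ℕ} (V : PBM n m) (x : Matrix (Fin n) (Fin m) ℝ) (k : Fin m) : ℝ :=
  ∑ i, (∑ j, if j ≤ k then V.best i j - x i j else 0) * V.α i

theorem dot_sub_best_eq {n m : ℕ} (V : PBM n m) {x : Matrix (Fin n) (Fin m) ℝ}
    (hx : x ∈ convexHull ℝ (actionSet n m)) :
    dot (x - V.best) V.meanLoss =
      ∑ k : Fin m, (V.betaExt k - V.betaExt (k + 1)) * V.prefixLoss x k := by
  have h1 : dot (x - V.best) V.meanLoss =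
      ∑ i, ∑ j, (V.best i j - x i j) * V.α i * V.β j := by
    have h0 : ∑ i, ∑ j, (x i j - V.best i j) = 0 := by
      rw [Finset.sum_comm]
      refine Finset.sum_eq_zero fun j _ => ?_
      rw [Finset.sum_sub_distrib, colSum_of_mem_hull hx, colSum_of_mem_hull V.best_mem_hull,
        sub_self]
    rw [← sub_eq_zero, ← h0]
    simp only [dot, meanLoss, ← Finset.sum_sub_distrib, Matrix.sub_apply]
    refine Finset.sum_congr rfl fun i _ => Finset.sum_congr rfl fun j _ => ?_
    ring
  rw [h1]
  simp only [prefixLoss, Finset.mul_sum, Finset.sum_mul]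
  rw [Finset.sum_comm' (t' := Finset.univ) (s' := fun _ => Finset.univ) (by simp)]
  conv_rhs => rw [Finset.sum_comm]
  rw [Finset.sum_comm]
  refine Finset.sum_congr rfl fun i _ => ?_
  conv_rhs => rw [Finset.sum_comm]
  refine Finset.sum_congr rfl fun j _ => ?_
  rw [V.beta_eq_sum j, Finset.mul_sum]
  refine Finset.sum_congr rfl fun k _ => ?_
  split_ifs <;> ring

/-- Each column of `best - x` sums to zero, so the attractivenesses may be centred. -/
theorem prefixLoss_eq {n m : ℕ} (V : PBM n m) {x : Matrix (Fin n) (Fin m) ℝ}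
    (hx : x ∈ convexHull ℝ (actionSet n m)) (k : Fin m) (c : ℝ) :
    V.prefixLoss x k = ∑ i : Fin n,
      ((if (i : ℕ) ≤ k then 1 else 0) - ∑ j, if j ≤ k then x i j else 0) * (V.α i - c) := by
  have hb : ∀ i : Fin n, (∑ j, if j ≤ k then V.best i j else 0) =
      if (i : ℕ) ≤ k then 1 else 0 := fun i => by
    split_ifs with h
    · rw [Finset.sum_eq_single (⟨i, h.trans_lt k.2⟩ : Fin m)]
      · rw [if_pos (Fin.le_def.2 h), best_apply]
        exact if_pos rfl
      · intro j _ hj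
        have hne : i ≠ Fin.castLE V.le j := fun h' => hj (Fin.ext (by simp [h']))
        simp [best_apply, hne]
      · simp
    · refine Finset.sum_eq_zero fun j _ => ?_
      split_ifs with hj
      · rw [best_apply, if_neg]
        rintro rfl
        exact h (Fin.le_def.1 hj)
      · rfl
  have h0 : ∑ i, (∑ j, if j ≤ k then V.best i j - x i j else 0) = 0 := by
    rw [Finset.sum_comm]
    refine Finset.sum_eq_zero fun j _ => ?_
    split_ifs
    · rw [Finset.sum_sub_distrib, colSum_of_mem_hull hx, colSum_of_mem_hull V.best_mem_hull,
        sub_self]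
    · simp
  have h2 : ∀ i : Fin n, ((if (i : ℕ) ≤ k then 1 else 0) - ∑ j, if j ≤ k then x i j else 0) =
      ∑ j, if j ≤ k then V.best i j - x i j else 0 := fun i => by
    rw [← hb i, ← Finset.sum_sub_distrib]
    refine Finset.sum_congr rfl fun j _ => ?_
    split_ifs <;> simp
  simp only [h2, mul_sub, Finset.sum_sub_distrib]
  rw [← Finset.sum_mul, h0, zero_mul, sub_zero]
  rfl

theorem prefixSum_le_one {n m : ℕ} {x : Matrix (Fin n) (Fin m) ℝ}
    (hx : x ∈ convexHull ℝ (actionSet n m)) (i : Fin n) (k : Fin m) :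
    (∑ j, if j ≤ k then x i j else 0) ≤ 1 := by
  refine (Finset.sum_le_sum fun j _ => ?_).trans (rowSum_of_mem_hull hx i)
  split_ifs
  · exact le_rfl
  · exact nonneg_of_mem_hull hx i j

theorem prefixSum_nonneg {n m : ℕ} {x : Matrix (Fin n) (Fin m) ℝ}
    (hx : x ∈ convexHull ℝ (actionSet n m)) (i : Fin n) (k : Fin m) :
    0 ≤ (∑ j, if j ≤ k then x i j else 0) := by
  refine Finset.sum_nonneg fun j _ => ?_
  split_ifs
  · exact nonneg_of_mem_hull hx i j
  · exact le_rfl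

/-- Centring at `α k`: every item ranked below `k` that is put at position `k` costs. -/
theorem prefixLoss_ge_below {n m : ℕ} (V : PBM n m) {x : Matrix (Fin n) (Fin m) ℝ}
    (hx : x ∈ convexHull ℝ (actionSet n m)) (k : Fin m) :
    ∑ i : Fin n, (if (k : ℕ) < i then x i k * (V.α (Fin.castLE V.le k) - V.α i) else 0) ≤
      V.prefixLoss x k := by
  rw [V.prefixLoss_eq hx k (V.α (Fin.castLE V.le k))]
  refine Finset.sum_le_sum fun i _ => ?_
  by_cases h : (k : ℕ) < i
  · rw [if_pos h, if_neg (by omega)]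
    have h1 : x i k ≤ ∑ j, if j ≤ k then x i j else 0 := by
      have := Finset.single_le_sum (f := fun j => if j ≤ k then x i j else 0) (fun j _ => by
        split_ifs
        · exact nonneg_of_mem_hull hx i j
        · exact le_rfl) (Finset.mem_univ k)
      simpa using this
    have h2 : V.α i ≤ V.α (Fin.castLE V.le k) := V.alpha_anti (Fin.le_def.2 h.le)
    nlinarith
  · rw [if_neg h, if_pos (by omega)]
    have h2 : V.α (Fin.castLE V.le k) ≤ V.α i := V.alpha_anti (Fin.le_def.2 (by
      simp only [Fin.val_castLE]; omega))
    exact mul_nonneg (sub_nonneg.2 (prefixSum_le_one hx i k)) (sub_nonneg.2 h2)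

/-- Centring at `α (k + 1)`: every item ranked above `k + 1` that is put at position `k + 1`
costs, since it is then missing from the first `k + 1` positions. -/
theorem prefixLoss_ge_above {n m : ℕ} (V : PBM n m) {x : Matrix (Fin n) (Fin m) ℝ}
    (hx : x ∈ convexHull ℝ (actionSet n m)) (k : Fin m) (hk : (k : ℕ) + 1 < m) :
    ∑ i : Fin n, (if (i : ℕ) < k + 1 then
      x i ⟨k + 1, hk⟩ * (V.α i - V.α (Fin.castLE V.le ⟨k + 1, hk⟩)) else 0) ≤
      V.prefixLoss x k := by
  rw [V.prefixLoss_eq hx k (V.α (Fin.castLE V.le ⟨k + 1, hk⟩))]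
  refine Finset.sum_le_sum fun i _ => ?_
  by_cases h : (i : ℕ) < k + 1
  · rw [if_pos h, if_pos (by omega)]
    have h1 : x i ⟨k + 1, hk⟩ + ∑ j, (if j ≤ k then x i j else 0) ≤ 1 := by
      refine le_trans ?_ (rowSum_of_mem_hull hx i)
      rw [← Finset.add_sum_erase _ _ (Finset.mem_univ (⟨k + 1, hk⟩ : Fin m)),
        ← Finset.add_sum_erase _ (x i) (Finset.mem_univ (⟨k + 1, hk⟩ : Fin m)),
        if_neg (by simp [Fin.le_def]), zero_add]
      refine add_le_add_right (Finset.sum_le_sum fun j _ => ?_) _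
      split_ifs
      · exact le_rfl
      · exact nonneg_of_mem_hull hx i j
    have h2 : V.α (Fin.castLE V.le ⟨k + 1, hk⟩) ≤ V.α i :=
      V.alpha_anti (Fin.le_def.2 h.le)
    nlinarith
  · rw [if_neg h, if_neg (by omega)]
    have h2 : V.α i ≤ V.α (Fin.castLE V.le ⟨k + 1, hk⟩) := V.alpha_anti (Fin.le_def.2 (by
      simp only [Fin.val_castLE]; omega))
    have := prefixSum_nonneg hx i k
    nlinarith

/-- Self-bounding: the instantaneous regret of `x` controls the mass that `x` puts on suboptimal
entries. The entries below and above the diagonal are each charged to the full regret, whence the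
factor `1 / 2`. -/
theorem half_sum_gap_le {n m : ℕ} (V : PBM n m) {x : Matrix (Fin n) (Fin m) ℝ}
    (hx : x ∈ convexHull ℝ (actionSet n m)) :
    1 / 2 * ∑ j, ∑ i, V.gap i j * x i j ≤ dot (x - V.best) V.meanLoss := by
  have hγ : ∀ k : Fin m, 0 ≤ V.betaExt k - V.betaExt (k + 1) := fun k =>
    (sub_pos.2 (V.betaExt_succ_lt k.2)).le
  have hbelow : ∑ j : Fin m, ∑ i : Fin n, (if (j : ℕ) < i then V.gap i j * x i j else 0) ≤
      dot (x - V.best) V.meanLoss := by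
    rw [V.dot_sub_best_eq hx]
    refine Finset.sum_le_sum fun k _ => ?_
    refine le_trans (le_of_eq ?_) (mul_le_mul_of_nonneg_left (V.prefixLoss_ge_below hx k) (hγ k))
    rw [Finset.mul_sum]
    refine Finset.sum_congr rfl fun i _ => ?_
    split_ifs with h
    · rw [gap, if_pos h]; ring
    · simp
  have habove : ∑ j : Fin m, ∑ i : Fin n, (if (i : ℕ) < j then V.gap i j * x i j else 0) ≤
      dot (x - V.best) V.meanLoss := by
    rw [V.dot_sub_best_eq hx]
    have hG : ∑ j : Fin m, ∑ i : Fin n, (if (i : ℕ) < j then V.gap i j * x i j else 0) =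
        ∑ j : Fin m, if (j : ℕ) = 0 then 0 else
          ∑ i : Fin n, (if (i : ℕ) < j then V.gap i j * x i j else 0) := by
      refine Finset.sum_congr rfl fun j _ => ?_
      split_ifs with h
      · simp [h]
      · rfl
    rw [hG, ← sum_fin_shift]
    refine Finset.sum_le_sum fun k _ => ?_
    split_ifs with hk
    · refine le_trans (le_of_eq ?_)
        (mul_le_mul_of_nonneg_left (V.prefixLoss_ge_above hx k hk) (hγ k))
      rw [Finset.mul_sum]
      refine Finset.sum_congr rfl fun i _ => ?_
      dsimp only
      split_ifs with h
      · rw [gap, if_neg (by dsimp only; omega), if_neg (by dsimp only; omega)]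
        simp only [Nat.add_sub_cancel]
        ring
      · simp
    · have h := V.prefixLoss_ge_below hx k
      refine mul_nonneg (hγ k) (le_trans (Finset.sum_nonneg fun i _ => ?_) h)
      split_ifs with hi
      · exact mul_nonneg (nonneg_of_mem_hull hx i k)
          (sub_nonneg.2 (V.alpha_anti (Fin.le_def.2 hi.le)))
      · exact le_rfl
  have hsplit : ∑ j, ∑ i, V.gap i j * x i j =
      ∑ j : Fin m, ∑ i : Fin n, (if (j : ℕ) < i then V.gap i j * x i j else 0) +
      ∑ j : Fin m, ∑ i : Fin n, (if (i : ℕ) < j then V.gap i j * x i j else 0) := by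
    simp only [← Finset.sum_add_distrib]
    refine Finset.sum_congr rfl fun j _ => Finset.sum_congr rfl fun i _ => ?_
    rcases lt_trichotomy (i : ℕ) j with h | h | h
    · rw [if_pos h, if_neg (by omega), zero_add]
    · rw [if_neg (by omega), if_neg (by omega), gap, if_neg (by omega), if_pos h.symm]
      ring
    · rw [if_pos h, if_neg (by omega), add_zero]
  rw [hsplit]
  linarith

theorem dot_sub_best_nonneg {n m : ℕ} (V : PBM n m) {x : Matrix (Fin n) (Fin m) ℝ}
    (hx : x ∈ convexHull ℝ (actionSet n m)) : 0 ≤ dot (x - V.best) V.meanLoss := by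
  refine le_trans ?_ (V.half_sum_gap_le hx)
  have := Finset.sum_nonneg fun (j : Fin m) (_ : j ∈ Finset.univ) =>
    Finset.sum_nonneg fun (i : Fin n) (_ : i ∈ Finset.univ) =>
      mul_nonneg (V.gap_nonneg i j) (nonneg_of_mem_hull hx i j)
  linarith

/-- The instantaneous regret is at most the mass that `x` puts on suboptimal entries. -/
theorem dot_sub_best_le {n m : ℕ} (V : PBM n m) {x : Matrix (Fin n) (Fin m) ℝ}
    (hx : x ∈ convexHull ℝ (actionSet n m)) :
    dot (x - V.best) V.meanLoss ≤ ∑ j, ∑ i with i ≠ Fin.castLE V.le j, x i j := by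
  unfold dot
  rw [Finset.sum_comm]
  refine Finset.sum_le_sum fun j _ => ?_
  have hL : ∀ i, 0 ≤ V.meanLoss i j ∧ V.meanLoss i j ≤ 1 := fun i => by
    have h1 := mul_nonneg (V.alpha_nonneg i) (V.beta_pos j).le
    have h2 := mul_le_one₀ (V.alpha_le_one i) (V.beta_pos j).le (V.beta_le_one j)
    constructor <;> simp only [meanLoss] <;> linarith
  rw [Finset.sum_filter]
  refine Finset.sum_le_sum fun i _ => ?_
  rw [Matrix.sub_apply, best_apply]
  obtain ⟨hL0, hL1⟩ := hL i
  have h0 := nonneg_of_mem_hull hx i j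
  have h1 := le_one_of_mem_hull hx i j
  by_cases h : i = Fin.castLE V.le j
  · rw [if_pos h, if_neg (not_not.2 h)]
    exact mul_nonpos_of_nonpos_of_nonneg (by linarith) hL0
  · rw [if_neg h, if_pos h, sub_zero]
    exact mul_le_of_le_one_right h0 hL1

/-! ### The regularized leader -/

theorem dot_add_left {n m : ℕ} (x y L : Matrix (Fin n) (Fin m) ℝ) :
    dot (x + y) L = dot x L + dot y L := by
  simp only [dot, Matrix.add_apply, add_mul, Finset.sum_add_distrib]

theorem dot_sub_left {n m : ℕ} (x y L : Matrix (Fin n) (Fin m) ℝ) :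
    dot (x - y) L = dot x L - dot y L := by
  simp only [dot, Matrix.sub_apply, sub_mul, Finset.sum_sub_distrib]

theorem dot_smul_left {n m : ℕ} (c : ℝ) (x L : Matrix (Fin n) (Fin m) ℝ) :
    dot (c • x) L = c * dot x L := by
  simp only [dot, Matrix.smul_apply, smul_eq_mul, mul_assoc, Finset.mul_sum]

theorem dot_add_right {n m : ℕ} (x L L' : Matrix (Fin n) (Fin m) ℝ) :
    dot x (L + L') = dot x L + dot x L' := by
  simp only [dot, Matrix.add_apply, mul_add, Finset.sum_add_distrib]

theorem dot_zero_right {n m : ℕ} (x : Matrix (Fin n) (Fin m) ℝ) : dot x 0 = 0 := by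
  simp [dot]

theorem IsLeader.le {n m t : ℕ} {L x y : Matrix (Fin n) (Fin m) ℝ} (h : IsLeader t L x)
    (hy : y ∈ convexHull ℝ (actionSet n m)) :
    dot x L + 2 * √(t : ℝ) * tsallis x ≤ dot y L + 2 * √(t : ℝ) * tsallis y := by
  have := h.2 hy
  simpa [learningRate] using this

/-- Moving from a point with a vanishing entry towards the uniform matrix decreases the
regularizer at an infinite rate, so the leader lies in the interior. -/
theorem IsLeader.pos {n m t : ℕ} {L x : Matrix (Fin n) (Fin m) ℝ} (h : IsLeader t L x)
    (ht : 1 ≤ t) (hmn : m ≤ n) (i : Fin n) (j : Fin m) : 0 < x i j := by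
  refine lt_of_le_of_ne (nonneg_of_mem_hull h.1 i j) fun h0 => ?_
  have hn : 0 < n := i.pos
  set u : Matrix (Fin n) (Fin m) ℝ := Matrix.of fun _ _ => 1 / (n : ℝ) with hu
  have huh : u ∈ convexHull ℝ (actionSet n m) := uniform_mem_hull hn hmn
  have hrt : 0 < √(t : ℝ) := Real.sqrt_pos.2 (by exact_mod_cast ht)
  have hrn : 0 < √(1 / (n : ℝ)) := Real.sqrt_pos.2 (by positivity)
  set K := dot u L - dot x L - 2 * √(t : ℝ) * tsallis x with hK
  set c := 2 * √(t : ℝ) * √(1 / (n : ℝ)) with hc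
  have hcpos : 0 < c := by positivity
  have key : ∀ a : ℝ, 0 < a → a ≤ 1 → c ≤ a * K := by
    intro a ha0 ha1
    have ha2 : a ^ 2 ≤ 1 := by nlinarith
    have hy : (1 - a ^ 2) • x + a ^ 2 • u ∈ convexHull ℝ (actionSet n m) :=
      (convex_convexHull ℝ _) h.1 huh (by linarith) (by positivity) (by ring)
    have hle := h.le hy
    have hts : tsallis ((1 - a ^ 2) • x + a ^ 2 • u) ≤
        (1 - a ^ 2) * tsallis x - a * √(1 / (n : ℝ)) := by
      have h1 : ∀ k l, (1 - a ^ 2) * √(x k l) + (if k = i ∧ l = j then a * √(1 / (n : ℝ)) else 0)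
          ≤ √(((1 - a ^ 2) • x + a ^ 2 • u) k l) := by
        intro k l
        have hx0 := nonneg_of_mem_hull h.1 k l
        simp only [hu, Matrix.add_apply, Matrix.smul_apply, smul_eq_mul, Matrix.of_apply]
        split_ifs with hkl
        · obtain ⟨rfl, rfl⟩ := hkl
          rw [← h0, Real.sqrt_zero, mul_zero, zero_add, zero_add,
            Real.sqrt_mul (by positivity), Real.sqrt_sq ha0.le]
        · rw [add_zero]
          refine Real.le_sqrt_of_sq_le ?_
          rw [mul_pow, Real.sq_sqrt hx0]
          have h2 : (1 - a ^ 2) ^ 2 * x k l ≤ (1 - a ^ 2) * x k l :=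
            mul_le_mul_of_nonneg_right (by nlinarith) hx0
          have h3 : 0 ≤ a ^ 2 * (1 / (n : ℝ)) := by positivity
          linarith
      have h2 := Finset.sum_le_sum fun k (_ : k ∈ Finset.univ) =>
        Finset.sum_le_sum fun l (_ : l ∈ Finset.univ) => h1 k l
      have h3 : ∑ k : Fin n, ∑ l : Fin m, (if k = i ∧ l = j then a * √(1 / (n : ℝ)) else 0) =
          a * √(1 / (n : ℝ)) := by
        rw [Finset.sum_eq_single i, Finset.sum_eq_single j] <;> simp +contextual
      simp only [Finset.sum_add_distrib, ← Finset.mul_sum] at h2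
      rw [h3] at h2
      simp only [tsallis, Finset.sum_neg_distrib]
      linarith
    rw [dot_add_left, dot_smul_left, dot_smul_left] at hle
    have h4 := mul_le_mul_of_nonneg_left hts (by positivity : 0 ≤ 2 * √(t : ℝ))
    have h5 : a * c ≤ a * (a * K) := by
      rw [hK, hc]
      linarith
    exact le_of_mul_le_mul_left h5 ha0
  have hK0 : c ≤ K := by simpa using key 1 one_pos le_rfl
  have hKp : 0 < K := hcpos.trans_le hK0
  have := key (c / (2 * K)) (by positivity) (by rw [div_le_one (by linarith)]; linarith)
  rw [div_mul_eq_mul_div, le_div_iff₀ (by linarith)] at this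
  nlinarith

theorem le_sqrt_quadratic {s w : ℝ} (hs : 0 < s) (hw : 0 ≤ w) :
    s + (w ^ 2 - s ^ 2) / (2 * s) - (w ^ 2 - s ^ 2) ^ 2 / (2 * s ^ 3) ≤ w := by
  have h : w - (s + (w ^ 2 - s ^ 2) / (2 * s) - (w ^ 2 - s ^ 2) ^ 2 / (2 * s ^ 3)) =
      (w - s) ^ 2 * (w * (w + 2 * s)) / (2 * s ^ 3) := by
    field_simp
    ring
  have h2 : 0 ≤ (w - s) ^ 2 * (w * (w + 2 * s)) / (2 * s ^ 3) := by positivity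
  linarith

theorem le_of_forall_le_add_mul {A B Q : ℝ} (h : ∀ a : ℝ, 0 < a → a ≤ 1 → B ≤ A + a * Q) :
    B ≤ A := by
  refine le_of_forall_pos_le_add fun ε hε => ?_
  have hQ : 0 < |Q| + 1 := by positivity
  have h1 := h (min 1 (ε / (|Q| + 1))) (lt_min one_pos (by positivity)) (min_le_left _ _)
  have h2 : min 1 (ε / (|Q| + 1)) * Q ≤ ε / (|Q| + 1) * |Q| :=
    (mul_le_mul_of_nonneg_left (le_abs_self Q) (by positivity)).trans
      (mul_le_mul_of_nonneg_right (min_le_right _ _) (abs_nonneg Q))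
  have h3 : ε / (|Q| + 1) * |Q| ≤ ε := by
    rw [div_mul_eq_mul_div, div_le_iff₀ hQ]
    nlinarith
  linarith

/-- First-order optimality of the leader. -/
theorem IsLeader.first_order {n m t : ℕ} {L x y : Matrix (Fin n) (Fin m) ℝ}
    (h : IsLeader t L x) (ht : 1 ≤ t) (hmn : m ≤ n) (hy : y ∈ convexHull ℝ (actionSet n m)) :
    √(t : ℝ) * ∑ i, ∑ j, (y i j - x i j) / √(x i j) ≤ dot y L - dot x L := by
  refine le_of_forall_le_add_mul
    (Q := √(t : ℝ) * ∑ i, ∑ j, (y i j - x i j) ^ 2 / √(x i j) ^ 3) fun a ha0 ha1 => ?_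
  have hz : (1 - a) • x + a • y ∈ convexHull ℝ (actionSet n m) :=
    (convex_convexHull ℝ _) h.1 hy (by linarith) ha0.le (by ring)
  have hle := h.le hz
  rw [dot_add_left, dot_smul_left, dot_smul_left] at hle
  have hts : ∑ i, ∑ j, (√(x i j) + a / 2 * ((y i j - x i j) / √(x i j)) -
      a ^ 2 / 2 * ((y i j - x i j) ^ 2 / √(x i j) ^ 3)) ≤
      ∑ i, ∑ j, √(((1 - a) • x + a • y) i j) := by
    refine Finset.sum_le_sum fun i _ => Finset.sum_le_sum fun j _ => ?_
    have hx := h.pos ht hmn i j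
    have hs := Real.sqrt_pos.2 hx
    have hq := le_sqrt_quadratic hs (Real.sqrt_nonneg (((1 - a) • x + a • y) i j))
    rw [Real.sq_sqrt (nonneg_of_mem_hull hz i j), Real.sq_sqrt hx.le] at hq
    refine le_trans (le_of_eq ?_) hq
    simp only [Matrix.add_apply, Matrix.smul_apply, smul_eq_mul]
    field_simp
    ring
  simp only [Finset.sum_add_distrib, Finset.sum_sub_distrib, ← Finset.mul_sum] at hts
  simp only [tsallis, Finset.sum_neg_distrib] at hle
  have h4 := mul_le_mul_of_nonneg_left hts (by positivity : 0 ≤ 2 * √(t : ℝ))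
  refine le_of_mul_le_mul_left ?_ ha0
  nlinarith

/-- The objective exceeds its minimum at least by the Bregman divergence of the regularizer. -/
theorem IsLeader.bregman {n m t : ℕ} {L x y : Matrix (Fin n) (Fin m) ℝ}
    (h : IsLeader t L x) (ht : 1 ≤ t) (hmn : m ≤ n) (hy : y ∈ convexHull ℝ (actionSet n m)) :
    dot x L + 2 * √(t : ℝ) * tsallis x + ∑ i, ∑ j, √(t : ℝ) * (√(y i j) - √(x i j)) ^ 2 / √(x i j)
      ≤ dot y L + 2 * √(t : ℝ) * tsallis y := by
  have hfo := h.first_order ht hmn hy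
  have heq : ∑ i, ∑ j, √(t : ℝ) * (√(y i j) - √(x i j)) ^ 2 / √(x i j) =
      √(t : ℝ) * (∑ i, ∑ j, (y i j - x i j) / √(x i j)) +
        2 * √(t : ℝ) * tsallis y - 2 * √(t : ℝ) * tsallis x := by
    simp only [tsallis, Finset.mul_sum, ← Finset.sum_add_distrib, ← Finset.sum_sub_distrib]
    refine Finset.sum_congr rfl fun i _ => Finset.sum_congr rfl fun j _ => ?_
    have hx := h.pos ht hmn i j
    have hs := Real.sqrt_pos.2 hx
    have h1 := Real.sq_sqrt hx.le
    have h2 := Real.sq_sqrt (nonneg_of_mem_hull hy i j)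
    rw [← h1, ← h2, Real.sqrt_sq hs.le, Real.sqrt_sq (Real.sqrt_nonneg _)]
    field_simp
    ring
  rw [heq]
  linarith

/-! ### Stability of the iterates -/

/-- The importance-weighted estimate of the loss matrix `N` when the list `a` was drawn from a
distribution with mean `x`. -/
def lossEstimate {n m : ℕ} (N : Fin n → Fin m → Bool) (a : Fin m ↪ Fin n)
    (x : Matrix (Fin n) (Fin m) ℝ) : Matrix (Fin n) (Fin m) ℝ :=
  fun i j => lossMatrix N i j * listMatrix a i j / x i j

/-- The bound on the stability term of round `t` at the leader `x` when the list `a` is drawn. -/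
def stabBound {n m : ℕ} (t : ℕ) (x : Matrix (Fin n) (Fin m) ℝ) (a : Fin m ↪ Fin n) : ℝ :=
  ∑ i, ∑ j, if a j = i then (1 - x i j) ^ 2 / (√(x i j) * √(t : ℝ))
    else x i j * √(x i j) / (√(t : ℝ) - √(x i j))

theorem stability_of_nonneg {s u r v : ℝ} (hs : 0 < s) (hr : 0 < r) (hv : 0 ≤ v) :
    (s ^ 2 - u ^ 2) * v ≤ r * (u - s) ^ 2 / s + s ^ 3 * v ^ 2 / r := by
  have h : r * (u - s) ^ 2 / s + s ^ 3 * v ^ 2 / r - (s ^ 2 - u ^ 2) * v =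
      (r * (u - s) + s ^ 2 * v) ^ 2 / (s * r) + v * (u - s) ^ 2 := by
    field_simp
    ring
  have h2 : 0 ≤ (r * (u - s) + s ^ 2 * v) ^ 2 / (s * r) + v * (u - s) ^ 2 := by positivity
  linarith

theorem stability_of_neg_one {s u r : ℝ} (hs : 0 < s) (hr : s < r) :
    (s ^ 2 - u ^ 2) * (-1) ≤ r * (u - s) ^ 2 / s + s ^ 3 / (r - s) := by
  have hrs : 0 < r - s := sub_pos.2 hr
  have h : r * (u - s) ^ 2 / s + s ^ 3 / (r - s) - (s ^ 2 - u ^ 2) * (-1) =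
      ((r - s) * (u - s) - s ^ 2) ^ 2 / (s * (r - s)) := by
    field_simp
    ring
  have h2 : 0 ≤ ((r - s) * (u - s) - s ^ 2) ^ 2 / (s * (r - s)) := by positivity
  linarith

/-- The stability term. Since the columns of `x - y` sum to zero, the estimate in column `j` may be
shifted by the loss of the item played there; this makes the bound of order `1 - x i j` near the
vertices. -/
theorem stability {n m t : ℕ} (ht : 1 ≤ t) {x y : Matrix (Fin n) (Fin m) ℝ}
    (hx : x ∈ convexHull ℝ (actionSet n m)) (hpos : ∀ i j, 0 < x i j)
    (hy : y ∈ convexHull ℝ (actionSet n m)) (N : Fin n → Fin m → Bool) (a : Fin m ↪ Fin n) :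
    dot x (lossEstimate N a x) ≤ dot y (lossEstimate N a x) +
      ∑ i, ∑ j, √(t : ℝ) * (√(y i j) - √(x i j)) ^ 2 / √(x i j) + stabBound t x a := by
  have ht1 : 1 ≤ √(t : ℝ) := Real.one_le_sqrt.2 (by exact_mod_cast ht)
  have hshift : dot x (lossEstimate N a x) - dot y (lossEstimate N a x) =
      ∑ i, ∑ j, (x i j - y i j) * (lossEstimate N a x i j - lossMatrix N (a j) j) := by
    have h0 : ∑ i, ∑ j, (x i j - y i j) * lossMatrix N (a j) j = 0 := by
      rw [Finset.sum_comm]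
      refine Finset.sum_eq_zero fun j _ => ?_
      rw [← Finset.sum_mul, Finset.sum_sub_distrib, colSum_of_mem_hull hx, colSum_of_mem_hull hy,
        sub_self, zero_mul]
    simp only [mul_sub, Finset.sum_sub_distrib, h0, sub_zero]
    rw [← dot_sub_left]
    rfl
  have hle : dot x (lossEstimate N a x) - dot y (lossEstimate N a x) ≤
      ∑ i, ∑ j, √(t : ℝ) * (√(y i j) - √(x i j)) ^ 2 / √(x i j) + stabBound t x a := by
    rw [hshift, stabBound]
    simp only [← Finset.sum_add_distrib]
    refine Finset.sum_le_sum fun i _ => Finset.sum_le_sum fun j _ => ?_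
    have hxp := hpos i j
    have hx1 := le_one_of_mem_hull hx i j
    have hs := Real.sqrt_pos.2 hxp
    have hs1 : √(x i j) ≤ 1 := Real.sqrt_le_one.2 hx1
    have hsx := Real.sq_sqrt hxp.le
    have hsy := Real.sq_sqrt (nonneg_of_mem_hull hy i j)
    have hr : 0 < √(t : ℝ) := by linarith
    have hD : 0 ≤ √(t : ℝ) * (√(y i j) - √(x i j)) ^ 2 / √(x i j) := by positivity
    simp only [lossEstimate, listMatrix]
    by_cases hij : a j = i
    · rw [if_pos hij, if_pos hij, hij]
      by_cases hN : N i j = true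
      · have hv : 0 ≤ 1 / x i j - 1 := by
          rw [sub_nonneg, one_le_div hxp]; exact hx1
        have := stability_of_nonneg (u := √(y i j)) hs hr hv
        rw [hsx, hsy] at this
        simp only [lossMatrix, hN, if_true, mul_one]
        refine this.trans (le_of_eq ?_)
        congr 1
        rw [pow_succ, hsx]
        field_simp
        rw [hsx]
      · simp only [lossMatrix, hN]
        simp only [Bool.false_eq_true, if_false, zero_mul, zero_div, sub_zero, mul_zero]
        positivity
    · rw [if_neg hij, if_neg hij]
      -- two items share the column, so this entry is smaller than one
      have hlt : x i j < 1 := by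
        have h1 := colSum_of_mem_hull hx j
        have h2 : ∑ k ∈ ({i, a j} : Finset (Fin n)), x k j ≤ ∑ k, x k j :=
          Finset.sum_le_sum_of_subset_of_nonneg (Finset.subset_univ _) fun k _ _ => (hpos k j).le
        rw [Finset.sum_pair (Ne.symm hij), h1] at h2
        linarith [hpos (a j) j]
      have hslt : √(x i j) < √(t : ℝ) := lt_of_lt_of_le (by
        rw [Real.sqrt_lt' one_pos, one_pow]; exact hlt) ht1
      have hrs := sub_pos.2 hslt
      by_cases hN : N (a j) j = true
      · have := stability_of_neg_one (u := √(y i j)) hs hslt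
        rw [pow_succ (√(x i j)) 2, hsx, hsy] at this
        simp only [lossMatrix, hN, if_true, mul_zero, zero_div, zero_sub]
        exact this
      · simp only [lossMatrix, hN]
        simp only [Bool.false_eq_true, if_false, mul_zero, zero_div, sub_zero, mul_zero]
        positivity
  linarith

/-- The increment of the inverse learning rate in round `t`. -/
def rateStep (t : ℕ) : ℝ := 2 * √(t : ℝ) - 2 * √((t : ℝ) - 1)

theorem sum_rateStep (T : ℕ) : ∑ t ∈ Finset.Icc 1 T, rateStep t = 2 * √(T : ℝ) := by
  induction T with
  | zero => simp
  | succ T ih =>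
    rw [Finset.sum_Icc_succ_top (by omega), ih, rateStep]
    push_cast
    rw [add_sub_cancel_right]
    ring

theorem isLeader_iterate {n m : ℕ} (hmn : m ≤ n) (M : ℕ → Fin n → Fin m → Bool)
    (A : ℕ → Fin m ↪ Fin n) (t : ℕ) : IsLeader t (cumLoss M A (t - 1)) (iterate M A t) :=
  leader_spec hmn _ _

theorem cumLoss_succ {n m : ℕ} (M : ℕ → Fin n → Fin m → Bool) (A : ℕ → Fin m ↪ Fin n) (t : ℕ) :
    cumLoss M A (t + 1) =
      cumLoss M A t + lossEstimate (M (t + 1)) (A (t + 1)) (iterate M A (t + 1)) := rfl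

/-- The standard induction for follow-the-regularized-leader: the optimal value of the objective
after `T` rounds dominates the estimated loss of the iterates up to stability and penalty terms. -/
theorem ftrl_le {n m : ℕ} (hmn : m ≤ n) (M : ℕ → Fin n → Fin m → Bool) (A : ℕ → Fin m ↪ Fin n)
    (T : ℕ) {y : Matrix (Fin n) (Fin m) ℝ} (hy : y ∈ convexHull ℝ (actionSet n m)) :
    ∑ t ∈ Finset.Icc 1 T, (dot (iterate M A t) (lossEstimate (M t) (A t) (iterate M A t)) -
        stabBound t (iterate M A t) (A t) + rateStep t * tsallis (iterate M A t)) ≤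
      dot y (cumLoss M A T) + 2 * √(T : ℝ) * tsallis y := by
  induction T generalizing y with
  | zero => simp [cumLoss, dot_zero_right]
  | succ T ih =>
    rw [Finset.sum_Icc_succ_top (by omega)]
    have hL := isLeader_iterate hmn M A (T + 1)
    rw [Nat.add_sub_cancel] at hL
    set x := iterate M A (T + 1) with hx
    have h1 := ih hL.1
    have h2 := hL.bregman (by omega) hmn hy
    have h3 := stability (t := T + 1) (by omega) hL.1 (hL.pos (by omega) hmn) hy (M (T + 1))
      (A (T + 1))
    rw [cumLoss_succ, dot_add_right, ← hx]
    have h4 : rateStep (T + 1) * tsallis x =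
        2 * √((T + 1 : ℕ) : ℝ) * tsallis x - 2 * √(T : ℝ) * tsallis x := by
      rw [rateStep]
      push_cast
      rw [add_sub_cancel_right]
      ring
    linarith

theorem tsallis_best {n m : ℕ} (V : PBM n m) : tsallis V.best = -m := by
  unfold tsallis
  rw [Finset.sum_comm]
  have : ∀ j : Fin m, ∑ i, -√(V.best i j) = -1 := fun j => by
    rw [Finset.sum_eq_single (Fin.castLE V.le j)]
    · simp [best_apply]
    · intro i _ hi
      simp [best_apply, hi]
    · simp
  simp [this]

theorem dot_cumLoss {n m : ℕ} (y : Matrix (Fin n) (Fin m) ℝ) (M : ℕ → Fin n → Fin m → Bool)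
    (A : ℕ → Fin m ↪ Fin n) (T : ℕ) : dot y (cumLoss M A T) =
      ∑ t ∈ Finset.Icc 1 T, dot y (lossEstimate (M t) (A t) (iterate M A t)) := by
  induction T with
  | zero => simp [cumLoss, dot_zero_right]
  | succ T ih => rw [Finset.sum_Icc_succ_top (by omega), cumLoss_succ, dot_add_right, ih]

/-- The regret of the iterates for the estimated losses, on every trajectory. -/
theorem estimated_regret_le {n m : ℕ} (V : PBM n m) (M : ℕ → Fin n → Fin m → Bool)
    (A : ℕ → Fin m ↪ Fin n) (T : ℕ) :
    ∑ t ∈ Finset.Icc 1 T,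
        dot (iterate M A t - V.best) (lossEstimate (M t) (A t) (iterate M A t)) ≤
      ∑ t ∈ Finset.Icc 1 T, (stabBound t (iterate M A t) (A t) +
        rateStep t * (-tsallis (iterate M A t) - m)) := by
  have h := ftrl_le V.le M A T V.best_mem_hull
  rw [tsallis_best, dot_cumLoss, ← sum_rateStep, Finset.sum_mul, ← Finset.sum_add_distrib] at h
  have h2 := sub_nonneg.2 h
  rw [← Finset.sum_sub_distrib] at h2
  rw [← sub_nonneg, ← Finset.sum_sub_distrib]
  refine h2.trans (le_of_eq (Finset.sum_congr rfl fun t _ => ?_))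
  rw [dot_sub_left]
  ring

/-! ### Expectations over the interaction -/

theorem sum_lossWeight {n m : ℕ} (w : Fin n → Fin m → Bool → ℝ) :
    ∑ N : Fin n → Fin m → Bool, ∏ i, ∏ j, w i j (N i j) = ∏ i, ∏ j, (w i j true + w i j false) := by
  have h1 : ∀ i, ∏ j, (w i j true + w i j false) = ∑ p : Fin m → Bool, ∏ j, w i j (p j) :=
    fun i => by
      have := Finset.prod_univ_sum (fun _ : Fin m => (Finset.univ : Finset Bool)) (w i)
      rw [Fintype.piFinset_univ] at this
      simpa only [Fintype.sum_bool] using this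
  simp only [h1]
  have := Finset.prod_univ_sum (fun _ : Fin n => (Finset.univ : Finset (Fin m → Bool)))
    (fun i p => ∏ j, w i j (p j))
  rw [Fintype.piFinset_univ] at this
  exact this.symm

theorem sum_lossProb {n m : ℕ} (V : PBM n m) : ∑ N, V.lossProb N = 1 := by
  refine (sum_lossWeight fun i j b => if b then 1 - V.α i * V.β j else V.α i * V.β j).trans ?_
  simp

theorem sum_lossProb_mul {n m : ℕ} (V : PBM n m) (i : Fin n) (j : Fin m) :
    ∑ N, V.lossProb N * lossMatrix N i j = V.meanLoss i j := by
  let w : Fin n → Fin m → Bool → ℝ := fun k l b =>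
    (if b then 1 - V.α k * V.β l else V.α k * V.β l) *
      (if k = i ∧ l = j then (if b then 1 else 0) else 1)
  have h : ∀ N : Fin n → Fin m → Bool,
      V.lossProb N * lossMatrix N i j = ∏ k, ∏ l, w k l (N k l) := fun N => by
    simp only [w, Finset.prod_mul_distrib]
    rw [lossProb]
    congr 1
    rw [Finset.prod_eq_single i, Finset.prod_eq_single j] <;>
      simp +contextual [lossMatrix]
  refine (Finset.sum_congr rfl fun N _ => h N).trans ((sum_lossWeight w).trans ?_)
  rw [Finset.prod_eq_single i, Finset.prod_eq_single j]
  · simp [w, meanLoss]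
  · intro l _ hl; simp [w, hl]
  · simp
  · intro k _ hk; simp [w, hk]
  · simp

theorem sum_pmf {ι : Type*} [Fintype ι] (p : PMF ι) : ∑ a, (p a).toReal = 1 := by
  rw [← ENNReal.toReal_sum fun a _ => p.apply_ne_top a, ← tsum_fintype (L := .unconditional _),
    p.tsum_coe]
  rfl

theorem IsSamplingRule.mean {n m : ℕ} {P : Matrix (Fin n) (Fin m) ℝ → PMF (Fin m ↪ Fin n)}
    (hP : IsSamplingRule P) {x : Matrix (Fin n) (Fin m) ℝ}
    (hx : x ∈ convexHull ℝ (actionSet n m)) (i : Fin n) (j : Fin m) :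
    ∑ a, (P x a).toReal * listMatrix a i j = x i j := by
  have := congrFun (congrFun (hP x hx) i) j
  rw [Matrix.sum_apply] at this
  simpa using this

/-- The conditional expectation of `g ℓ X` given a history after which the leader is `x`. -/
def condMean {n m : ℕ} (V : PBM n m) (P : Matrix (Fin n) (Fin m) ℝ → PMF (Fin m ↪ Fin n))
    (x : Matrix (Fin n) (Fin m) ℝ) (g : (Fin n → Fin m → Bool) → (Fin m ↪ Fin n) → ℝ) : ℝ :=
  ∑ N, ∑ a, V.lossProb N * (P x a).toReal * g N a

theorem condMean_of_list {n m : ℕ} (V : PBM n m)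
    (P : Matrix (Fin n) (Fin m) ℝ → PMF (Fin m ↪ Fin n)) (x : Matrix (Fin n) (Fin m) ℝ)
    (g : (Fin m ↪ Fin n) → ℝ) :
    V.condMean P x (fun _ a => g a) = ∑ a, (P x a).toReal * g a := by
  simp only [condMean, mul_assoc, ← Finset.mul_sum]
  rw [← Finset.sum_mul, sum_lossProb, one_mul]

theorem condMean_mul {n m : ℕ} (V : PBM n m)
    (P : Matrix (Fin n) (Fin m) ℝ → PMF (Fin m ↪ Fin n)) (x : Matrix (Fin n) (Fin m) ℝ)
    (f : (Fin n → Fin m → Bool) → ℝ) (g : (Fin m ↪ Fin n) → ℝ) :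
    V.condMean P x (fun N a => f N * g a) =
      (∑ N, V.lossProb N * f N) * ∑ a, (P x a).toReal * g a := by
  rw [condMean, Finset.sum_mul_sum]
  refine Finset.sum_congr rfl fun N _ => Finset.sum_congr rfl fun a _ => ?_
  ring

theorem condMean_sum {n m : ℕ} (V : PBM n m)
    (P : Matrix (Fin n) (Fin m) ℝ → PMF (Fin m ↪ Fin n)) (x : Matrix (Fin n) (Fin m) ℝ)
    {ι : Type*} (s : Finset ι) (g : ι → (Fin n → Fin m → Bool) → (Fin m ↪ Fin n) → ℝ) :
    V.condMean P x (fun N a => ∑ k ∈ s, g k N a) = ∑ k ∈ s, V.condMean P x (g k) := by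
  simp only [condMean, Finset.mul_sum]
  symm
  rw [Finset.sum_comm]
  refine Finset.sum_congr rfl fun N _ => ?_
  rw [Finset.sum_comm]

theorem condMean_dot_list {n m : ℕ} (V : PBM n m)
    {P : Matrix (Fin n) (Fin m) ℝ → PMF (Fin m ↪ Fin n)} (hP : IsSamplingRule P)
    {x : Matrix (Fin n) (Fin m) ℝ} (hx : x ∈ convexHull ℝ (actionSet n m))
    (y : Matrix (Fin n) (Fin m) ℝ) :
    V.condMean P x (fun N a => dot (listMatrix a - y) (lossMatrix N)) =
      dot (x - y) V.meanLoss := by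
  simp only [dot, condMean_sum]
  refine Finset.sum_congr rfl fun i _ => Finset.sum_congr rfl fun j _ => ?_
  have := V.condMean_mul P x (fun N => lossMatrix N i j) (fun a => (listMatrix a - y) i j)
  simp only [mul_comm (lossMatrix _ i j)] at this
  rw [this, sum_lossProb_mul, mul_comm]
  congr 1
  simp only [Matrix.sub_apply, mul_sub, Finset.sum_sub_distrib]
  rw [hP.mean hx, ← Finset.sum_mul, sum_pmf, one_mul]

/-- The loss estimates are unbiased. -/
theorem condMean_dot_estimate {n m : ℕ} (V : PBM n m)
    {P : Matrix (Fin n) (Fin m) ℝ → PMF (Fin m ↪ Fin n)} (hP : IsSamplingRule P)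
    {x : Matrix (Fin n) (Fin m) ℝ} (hx : x ∈ convexHull ℝ (actionSet n m))
    (hpos : ∀ i j, 0 < x i j) (y : Matrix (Fin n) (Fin m) ℝ) :
    V.condMean P x (fun N a => dot (x - y) (lossEstimate N a x)) = dot (x - y) V.meanLoss := by
  simp only [dot, condMean_sum]
  refine Finset.sum_congr rfl fun i _ => Finset.sum_congr rfl fun j _ => ?_
  have h1 : ∀ (N : Fin n → Fin m → Bool) (a : Fin m ↪ Fin n),
      (x - y) i j * lossEstimate N a x i j =
        lossMatrix N i j * (listMatrix a i j * ((x - y) i j / x i j)) := fun N a => by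
    rw [lossEstimate]; ring
  simp only [h1]
  rw [condMean_mul, sum_lossProb_mul, mul_comm]
  congr 1
  simp only [← mul_assoc]
  rw [← Finset.sum_mul, hP.mean hx, mul_div_cancel₀ _ (hpos i j).ne']

/-- In expectation the two kinds of stability terms combine to `√x (1 - x) / √t`, up to a
contribution of lower order. -/
theorem condMean_stabBound_le {n m t : ℕ} (V : PBM n m) (ht : 1 ≤ t)
    {P : Matrix (Fin n) (Fin m) ℝ → PMF (Fin m ↪ Fin n)} (hP : IsSamplingRule P)
    {x : Matrix (Fin n) (Fin m) ℝ} (hx : x ∈ convexHull ℝ (actionSet n m))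
    (hpos : ∀ i j, 0 < x i j) :
    V.condMean P x (fun _ a => stabBound t x a) ≤
      ∑ j, ∑ i, √(x i j) * (1 - x i j) / √(t : ℝ) + 2 * m / t := by
  have ht0 : (1 : ℝ) ≤ t := by exact_mod_cast ht
  have ht1 : 1 ≤ √(t : ℝ) := Real.one_le_sqrt.2 ht0
  have hr : 0 < √(t : ℝ) := by linarith
  have hentry : ∀ i j, V.condMean P x (fun _ a => if a j = i then
      (1 - x i j) ^ 2 / (√(x i j) * √(t : ℝ)) else x i j * √(x i j) / (√(t : ℝ) - √(x i j))) ≤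
      √(x i j) * (1 - x i j) / √(t : ℝ) + 2 / t * x i j := by
    intro i j
    rw [condMean_of_list]
    have h1 : ∀ a : Fin m ↪ Fin n, (if a j = i then
        (1 - x i j) ^ 2 / (√(x i j) * √(t : ℝ)) else x i j * √(x i j) / (√(t : ℝ) - √(x i j))) =
        listMatrix a i j * ((1 - x i j) ^ 2 / (√(x i j) * √(t : ℝ))) +
          (1 - listMatrix a i j) * (x i j * √(x i j) / (√(t : ℝ) - √(x i j))) := fun a => by
      rw [listMatrix]
      split_ifs <;> ring
    simp only [h1, mul_add, Finset.sum_add_distrib, ← mul_assoc, ← Finset.sum_mul, mul_sub,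
      mul_one, Finset.sum_sub_distrib]
    rw [hP.mean hx, sum_pmf]
    have hxp := hpos i j
    have hx1 := le_one_of_mem_hull hx i j
    have hs := Real.sqrt_pos.2 hxp
    have hs1 : √(x i j) ≤ 1 := Real.sqrt_le_one.2 hx1
    have hsx := Real.sq_sqrt hxp.le
    have htt := Real.sq_sqrt (zero_le_one.trans ht0)
    set s := √(x i j)
    set r := √(t : ℝ)
    rw [← htt, ← hsx]
    rcases (hs1.trans ht1).eq_or_lt with hsr | hsr
    · have hs' : s = 1 := by linarith
      have hr' : r = 1 := by linarith
      rw [hs', hr']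
      norm_num
    · have hrs := sub_pos.2 hsr
      have h3 : 0 ≤ 2 * (r - s) - r * s ^ 2 * (1 - s ^ 2) := by
        have h4 : s ^ 2 * (1 - s ^ 2) ≤ 1 - s ^ 2 := by nlinarith [sq_nonneg s]
        have h5 : s ^ 2 * (1 - s ^ 2) ≤ 2 * (1 - s) := by nlinarith
        have h6 : r * (s ^ 2 * (1 - s ^ 2)) ≤ r * (2 * (1 - s)) :=
          mul_le_mul_of_nonneg_left h5 hr.le
        nlinarith
      have h7 : 0 ≤ s ^ 2 * (2 * (r - s) - r * s ^ 2 * (1 - s ^ 2)) / (r ^ 2 * (r - s)) := by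
        positivity
      rw [← sub_nonneg]
      refine h7.trans (le_of_eq ?_)
      field_simp
      ring
  simp only [stabBound, condMean_sum]
  rw [Finset.sum_comm]
  refine (Finset.sum_le_sum fun j _ => Finset.sum_le_sum fun i _ => hentry i j).trans ?_
  simp only [Finset.sum_add_distrib, ← Finset.mul_sum, colSum_of_mem_hull hx]
  refine le_of_eq ?_
  simp
  ring

theorem cumLoss_congr {n m : ℕ} {M M' : ℕ → Fin n → Fin m → Bool} {A A' : ℕ → Fin m ↪ Fin n}
    {t : ℕ} (hM : ∀ s ∈ Finset.Icc 1 t, M s = M' s) (hA : ∀ s ∈ Finset.Icc 1 t, A s = A' s) :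
    cumLoss M A t = cumLoss M' A' t := by
  induction t with
  | zero => rfl
  | succ t ih =>
    have hsub := Finset.Icc_subset_Icc_right (a := 1) t.le_succ
    ext i j
    simp only [cumLoss]
    rw [ih (fun s hs => hM s (hsub hs)) (fun s hs => hA s (hsub hs)), hM _ (by simp),
      hA _ (by simp)]

theorem integral_comp_fintype {Ω Z : Type*} [MeasurableSpace Ω] (μ : Measure Ω)
    [IsProbabilityMeasure μ] [Fintype Z] (F : Ω → Z) (hF : ∀ z, MeasurableSet {ω | F ω = z})
    (f : Z → ℝ) :
    Integrable (fun ω => f (F ω)) μ ∧ ∫ ω, f (F ω) ∂μ = ∑ z, μ.real {ω | F ω = z} * f z := by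
  classical
  have h : (fun ω => f (F ω)) = fun ω => ∑ z, Set.indicator {ω | F ω = z} (fun _ => f z) ω := by
    ext ω
    rw [Finset.sum_eq_single (F ω)]
    · simp
    · intro z _ hz
      simp [Ne.symm hz]
    · simp
  have hint : ∀ z ∈ Finset.univ,
      Integrable (Set.indicator {ω | F ω = z} (fun _ => f z)) μ := fun z _ =>
    (integrable_const (f z)).indicator (hF z)
  rw [h]
  refine ⟨integrable_finsetSum _ hint, ?_⟩
  rw [integral_finsetSum _ hint]
  refine Finset.sum_congr rfl fun z _ => ?_
  rw [integral_indicator_const _ (hF z), smul_eq_mul]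

/-- The history of the rounds `1, …, t`, as a random variable with finitely many values. -/
def history {n m : ℕ} {Ω : Type*} (ell : ℕ → Ω → Fin n → Fin m → Bool)
    (I : ℕ → Ω → Fin m ↪ Fin n) (t : ℕ) (ω : Ω) :
    Finset.Icc 1 t → (Fin n → Fin m → Bool) × (Fin m ↪ Fin n) :=
  fun s => (ell s ω, I s ω)

/-- The leader of round `t` as a random variable. -/
def leaderAt {n m : ℕ} {Ω : Type*} (ell : ℕ → Ω → Fin n → Fin m → Bool)
    (I : ℕ → Ω → Fin m ↪ Fin n) (t : ℕ) (ω : Ω) : Matrix (Fin n) (Fin m) ℝ :=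
  iterate (fun s => ell s ω) (fun s => I s ω) t

theorem leaderAt_mem_hull {n m : ℕ} (V : PBM n m) {Ω : Type*}
    (ell : ℕ → Ω → Fin n → Fin m → Bool) (I : ℕ → Ω → Fin m ↪ Fin n) (t : ℕ) (ω : Ω) :
    leaderAt ell I t ω ∈ convexHull ℝ (actionSet n m) :=
  (isLeader_iterate V.le _ _ t).1

theorem leaderAt_pos {n m : ℕ} (V : PBM n m) {Ω : Type*}
    (ell : ℕ → Ω → Fin n → Fin m → Bool) (I : ℕ → Ω → Fin m ↪ Fin n) {t : ℕ} (ht : 1 ≤ t)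
    (ω : Ω) (i : Fin n) (j : Fin m) : 0 < leaderAt ell I t ω i j :=
  (isLeader_iterate V.le _ _ t).pos ht V.le i j

section Run

variable {n m : ℕ} {V : PBM n m} {P : Matrix (Fin n) (Fin m) ℝ → PMF (Fin m ↪ Fin n)} {T : ℕ}
  {Ω : Type*} [MeasurableSpace Ω] {μ : Measure Ω}
  {ell : ℕ → Ω → Fin n → Fin m → Bool} {I : ℕ → Ω → Fin m ↪ Fin n}

theorem IsRun.measurable_history (h : IsRun V P T μ ell I) {t : ℕ} (ht : t ≤ T)
    (k : Finset.Icc 1 t → (Fin n → Fin m → Bool) × (Fin m ↪ Fin n)) :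
    MeasurableSet {ω | history ell I t ω = k} := by
  have heq : {ω | history ell I t ω = k} =
      ⋂ s : Finset.Icc 1 t, {ω | ell s ω = (k s).1} ∩ {ω | I s ω = (k s).2} := by
    ext ω
    simp [history, funext_iff, Prod.ext_iff]
  rw [heq]
  refine MeasurableSet.iInter fun s => ?_
  have hs := Finset.Icc_subset_Icc_right ht s.2
  exact (h.measurable_loss s hs _).inter (h.measurable_list s hs _)

/-- The tower property in round `t`. The law of the round given its history is checked on the
finitely many atoms. -/
theorem IsRun.integral_round [IsProbabilityMeasure μ] (h : IsRun V P T μ ell I) {t : ℕ}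
    (ht : t ∈ Finset.Icc 1 T)
    (g : Matrix (Fin n) (Fin m) ℝ → (Fin n → Fin m → Bool) → (Fin m ↪ Fin n) → ℝ) :
    Integrable (fun ω => g (leaderAt ell I t ω) (ell t ω) (I t ω)) μ ∧
      Integrable (fun ω => V.condMean P (leaderAt ell I t ω) (g (leaderAt ell I t ω))) μ ∧
      ∫ ω, g (leaderAt ell I t ω) (ell t ω) (I t ω) ∂μ =
        ∫ ω, V.condMean P (leaderAt ell I t ω) (g (leaderAt ell I t ω)) ∂μ := by
  have ht' := Finset.mem_Icc.1 ht
  -- extend a finite history by arbitrary values; the iterate of round `t` does not see them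
  let eM : (Finset.Icc 1 (t - 1) → (Fin n → Fin m → Bool) × (Fin m ↪ Fin n)) →
      (Fin n → Fin m → Bool) → ℕ → Fin n → Fin m → Bool :=
    fun k N s => if hs : s ∈ Finset.Icc 1 (t - 1) then (k ⟨s, hs⟩).1 else N
  let eA : (Finset.Icc 1 (t - 1) → (Fin n → Fin m → Bool) × (Fin m ↪ Fin n)) →
      (Fin m ↪ Fin n) → ℕ → Fin m ↪ Fin n :=
    fun k a s => if hs : s ∈ Finset.Icc 1 (t - 1) then (k ⟨s, hs⟩).2 else a
  let X := fun k => iterate (eM k fun _ _ => false) (eA k (Fin.castLEEmb V.le)) t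
  have hX : ∀ ω, leaderAt ell I t ω = X (history ell I (t - 1) ω) := fun ω => by
    refine congrArg (leader t) (cumLoss_congr (fun s hs => ?_) (fun s hs => ?_))
    · simp only [eM]; rw [dif_pos hs]; rfl
    · simp only [eA]; rw [dif_pos hs]; rfl
  have hXe : ∀ k N a, iterate (eM k N) (eA k a) t = X k := fun k N a => by
    refine congrArg (leader t) (cumLoss_congr (fun s hs => ?_) (fun s hs => ?_))
    · simp only [eM]; rw [dif_pos hs, dif_pos hs]
    · simp only [eA]; rw [dif_pos hs, dif_pos hs]
  have hmeas := h.measurable_history (t := t - 1) (by omega)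
  have hnot : t ∉ Finset.Icc 1 (t - 1) := by simp; omega
  have hev : ∀ k N a, historyEvent ell I (t - 1) (eM k N) (eA k a) =
      {ω | history ell I (t - 1) ω = k} := fun k N a => by
    ext ω
    simp only [historyEvent, Set.mem_ofPred_eq, funext_iff, Subtype.forall, history, Prod.ext_iff]
    refine forall₂_congr fun s hs => ?_
    simp only [eM, eA]
    rw [dif_pos hs, dif_pos hs]
  have hatom : ∀ k N a, μ.real {ω | (history ell I (t - 1) ω, ell t ω, I t ω) = (k, N, a)} =
      μ.real {ω | history ell I (t - 1) ω = k} * (V.lossProb N * (P (X k) a).toReal) := by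
    intro k N a
    have h1 := h.loss_law t ht (eM k N) (eA k a)
    have h2 := h.list_law t ht (eM k N) (eA k a)
    have hMt : eM k N t = N := dif_neg hnot
    have hAt : eA k a t = a := dif_neg hnot
    rw [h1, hXe, hMt, hAt, hev, mul_assoc] at h2
    rw [← h2]
    congr 1
    ext ω
    simp [and_assoc]
  have hI1 := integral_comp_fintype μ
    (fun ω => (history ell I (t - 1) ω, ell t ω, I t ω)) (fun ⟨k, N, a⟩ => by
      have heq : {ω | (history ell I (t - 1) ω, ell t ω, I t ω) = (k, N, a)} =
          {ω | history ell I (t - 1) ω = k} ∩ ({ω | ell t ω = N} ∩ {ω | I t ω = a}) := by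
        ext ω; simp
      rw [heq]
      exact (hmeas k).inter ((h.measurable_loss t ht N).inter (h.measurable_list t ht a)))
    (fun z => g (X z.1) z.2.1 z.2.2)
  have hI2 := integral_comp_fintype μ (fun ω => history ell I (t - 1) ω) hmeas
    (fun k => V.condMean P (X k) (g (X k)))
  simp only [hX]
  refine ⟨hI1.1, hI2.1, ?_⟩
  rw [hI1.2, hI2.2]
  simp only [Fintype.sum_prod_type]
  refine Finset.sum_congr rfl fun k _ => ?_
  rw [condMean, Finset.mul_sum]
  refine Finset.sum_congr rfl fun N _ => ?_
  rw [Finset.mul_sum]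
  refine Finset.sum_congr rfl fun a _ => ?_
  rw [hatom]
  ring

end Run

/-! ### Regret as a sum over the rounds -/

/-- The bound on stability plus penalty in round `t` at the leader `x`. -/
def roundBound {n m : ℕ} (t : ℕ) (x : Matrix (Fin n) (Fin m) ℝ) : ℝ :=
  ∑ j, ∑ i, √(x i j) * (1 - x i j) / √(t : ℝ) + 2 * m / t + rateStep t * (-tsallis x - m)

/-- The sum `∑ⱼ ∑_{i ≠ j} 1 / Δᵢⱼ`. -/
def invGapSum {n m : ℕ} (V : PBM n m) : ℝ :=
  ∑ j, ∑ i with i ≠ Fin.castLE V.le j, 1 / V.gap i j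

section Run

variable {n m : ℕ} {V : PBM n m} {P : Matrix (Fin n) (Fin m) ℝ → PMF (Fin m ↪ Fin n)} {T : ℕ}
  {Ω : Type*} [MeasurableSpace Ω] {μ : Measure Ω} [IsProbabilityMeasure μ]
  {ell : ℕ → Ω → Fin n → Fin m → Bool} {I : ℕ → Ω → Fin m ↪ Fin n}

theorem IsRun.integrable_leaderAt (h : IsRun V P T μ ell I) {t : ℕ} (ht : t ∈ Finset.Icc 1 T)
    (f : Matrix (Fin n) (Fin m) ℝ → ℝ) : Integrable (fun ω => f (leaderAt ell I t ω)) μ :=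
  (h.integral_round ht fun x _ _ => f x).1

theorem IsRun.regret_eq (h : IsRun V P T μ ell I) (hP : IsSamplingRule P)
    (y : Matrix (Fin n) (Fin m) ℝ) :
    regret μ ell I T y =
      ∑ t ∈ Finset.Icc 1 T, ∫ ω, dot (leaderAt ell I t ω - y) V.meanLoss ∂μ := by
  have hr := fun t (ht : t ∈ Finset.Icc 1 T) =>
    h.integral_round ht (fun _ N a => dot (listMatrix a - y) (lossMatrix N))
  rw [regret, integral_finsetSum _ fun t ht => (hr t ht).1]
  refine Finset.sum_congr rfl fun t ht => (hr t ht).2.2.trans ?_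
  refine integral_congr_ae (Filter.Eventually.of_forall fun ω => ?_)
  exact V.condMean_dot_list hP (leaderAt_mem_hull V ell I t ω) y

/-- The optimal action minimizes the mean loss, so it is the hardest comparator. -/
theorem IsRun.regret_le_regret_best (h : IsRun V P T μ ell I) (hP : IsSamplingRule P)
    {y : Matrix (Fin n) (Fin m) ℝ} (hy : y ∈ convexHull ℝ (actionSet n m)) :
    regret μ ell I T y ≤ regret μ ell I T V.best := by
  rw [h.regret_eq hP, h.regret_eq hP]
  refine Finset.sum_le_sum fun t ht => integral_mono
    (h.integrable_leaderAt ht fun x => dot (x - y) V.meanLoss)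
    (h.integrable_leaderAt ht fun x => dot (x - V.best) V.meanLoss) fun ω => ?_
  have := V.dot_sub_best_nonneg hy
  simp only [dot_sub_left] at this ⊢
  linarith

theorem IsRun.regret_best_le (h : IsRun V P T μ ell I) (hP : IsSamplingRule P) :
    regret μ ell I T V.best ≤
      ∑ t ∈ Finset.Icc 1 T, ∫ ω, roundBound t (leaderAt ell I t ω) ∂μ := by
  have hr := fun t (ht : t ∈ Finset.Icc 1 T) =>
    h.integral_round ht (fun x N a => dot (x - V.best) (lossEstimate N a x))
  have hs := fun t (ht : t ∈ Finset.Icc 1 T) =>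
    h.integral_round ht (fun x _ a => stabBound t x a)
  have hp := fun t (ht : t ∈ Finset.Icc 1 T) =>
    h.integrable_leaderAt ht fun x => rateStep t * (-tsallis x - m)
  have hsp : ∀ t ∈ Finset.Icc 1 T, Integrable (fun ω => stabBound t (leaderAt ell I t ω) (I t ω) +
      rateStep t * (-tsallis (leaderAt ell I t ω) - m)) μ := fun t ht => (hs t ht).1.add (hp t ht)
  have h1 : regret μ ell I T V.best = ∫ ω, ∑ t ∈ Finset.Icc 1 T,
      dot (leaderAt ell I t ω - V.best) (lossEstimate (ell t ω) (I t ω) (leaderAt ell I t ω)) ∂μ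
      := by
    rw [h.regret_eq hP, integral_finsetSum _ fun t ht => (hr t ht).1]
    refine Finset.sum_congr rfl fun t ht => Eq.symm ((hr t ht).2.2.trans ?_)
    refine integral_congr_ae (Filter.Eventually.of_forall fun ω => ?_)
    exact V.condMean_dot_estimate hP (leaderAt_mem_hull V ell I t ω)
      (leaderAt_pos V ell I (Finset.mem_Icc.1 ht).1 ω) V.best
  have h2 : ∫ ω, ∑ t ∈ Finset.Icc 1 T,
      dot (leaderAt ell I t ω - V.best) (lossEstimate (ell t ω) (I t ω) (leaderAt ell I t ω)) ∂μ ≤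
      ∫ ω, ∑ t ∈ Finset.Icc 1 T, (stabBound t (leaderAt ell I t ω) (I t ω) +
        rateStep t * (-tsallis (leaderAt ell I t ω) - m)) ∂μ := by
    refine integral_mono (integrable_finsetSum _ fun t ht => (hr t ht).1)
      (integrable_finsetSum _ hsp) fun ω => ?_
    exact estimated_regret_le V (fun s => ell s ω) (fun s => I s ω) T
  rw [h1]
  refine h2.trans ?_
  rw [integral_finsetSum _ hsp]
  refine Finset.sum_le_sum fun t ht => ?_
  rw [integral_add (hs t ht).1 (hp t ht)]
  refine (add_le_add_left (hs t ht).2.2.le _).trans ?_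
  rw [← integral_add (hs t ht).2.1 (hp t ht)]
  refine integral_mono ((hs t ht).2.1.add (hp t ht)) (h.integrable_leaderAt ht (roundBound t))
    fun ω => ?_
  have ht1 := (Finset.mem_Icc.1 ht).1
  exact add_le_add_left (V.condMean_stabBound_le ht1 hP (leaderAt_mem_hull V ell I t ω)
    (leaderAt_pos V ell I ht1 ω)) _

end Run

/-! ### The bound of a single round -/

theorem one_div_sqrt_le_rateStep {t : ℕ} (ht : 1 ≤ t) : 1 / √(t : ℝ) ≤ rateStep t := by
  have ht0 : (1 : ℝ) ≤ t := by exact_mod_cast ht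
  have hr : 0 < √(t : ℝ) := Real.sqrt_pos.2 (by linarith)
  have h1 := Real.sq_sqrt (by linarith : (0 : ℝ) ≤ t)
  have h2 := Real.sq_sqrt (by linarith : (0 : ℝ) ≤ (t : ℝ) - 1)
  rw [rateStep, div_le_iff₀ hr]
  nlinarith [sq_nonneg (√(t : ℝ) - √((t : ℝ) - 1))]

theorem rateStep_succ_le {t : ℕ} (ht : 1 ≤ t) : rateStep (t + 1) ≤ 1 / √(t : ℝ) := by
  have ht0 : (1 : ℝ) ≤ t := by exact_mod_cast ht
  have hr : 0 < √(t : ℝ) := Real.sqrt_pos.2 (by linarith)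
  have h1 := Real.sq_sqrt (by linarith : (0 : ℝ) ≤ t)
  have h2 := Real.sq_sqrt (by linarith : (0 : ℝ) ≤ (t : ℝ) + 1)
  rw [rateStep, le_div_iff₀ hr]
  push_cast
  rw [add_sub_cancel_right]
  nlinarith [sq_nonneg (√(t : ℝ) - √((t : ℝ) + 1))]

theorem diagonal_bound {s q r : ℝ} (hs0 : 0 ≤ s) (hs1 : s ≤ 1) (hr : 0 < r) (hq : 1 / r ≤ q) :
    s * (1 - s ^ 2) / r + q * (s - 1) ≤ (1 - s ^ 2) / 2 / r := by
  have h1 : q * (s - 1) ≤ 1 / r * (s - 1) := mul_le_mul_of_nonpos_right hq (by linarith)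
  have h2 : (1 - s ^ 2) / 2 / r - (s * (1 - s ^ 2) / r + 1 / r * (s - 1)) =
      (1 - s) ^ 2 * (s + 3 / 2) / r := by
    field_simp
    ring
  have h3 : 0 ≤ (1 - s) ^ 2 * (s + 3 / 2) / r := by positivity
  linarith

/-- Twice the contribution of a suboptimal entry `x` with gap `d`, minus its share `d * x / 2` of
the regret, is maximized over `x`. -/
theorem entry_bound {x r q q' d : ℝ} (hx0 : 0 ≤ x) (hx1 : x ≤ 1) (hr : 0 < r) (hq : q' ≤ 1 / r)
    (hqq : q' ≤ q) (hd0 : 0 < d) (hd1 : d ≤ 1) :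
    2 * (√x * (1 - x) / r + q * √x + x / 2 / r) - 1 / 2 * (d * x) ≤
      (25 / 2 * (1 / r ^ 2) + 2 * (q - q')) * (1 / d) := by
  have hs1 : √x ≤ 1 := Real.sqrt_le_one.2 hx1
  have hs0 := Real.sqrt_nonneg x
  have hsx := Real.sq_sqrt hx0
  set s := √x
  rw [← hsx]
  have hd : 1 ≤ 1 / d := (one_le_div hd0).2 hd1
  have h1 : (q - q') * s ≤ (q - q') * (1 / d) :=
    mul_le_mul_of_nonneg_left (hs1.trans hd) (sub_nonneg.2 hqq)
  have h2 : q' * s ≤ 1 / r * s := mul_le_mul_of_nonneg_right hq hs0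
  have h3 : s * (1 - s ^ 2) / r ≤ s / r := by
    gcongr
    nlinarith [mul_nonneg hs0 (sq_nonneg s)]
  have h4 : s ^ 2 / 2 / r ≤ s / 2 / r := by
    gcongr
    nlinarith
  have h5 : 25 / 2 * (1 / r ^ 2) * (1 / d) - (5 * (s / r) - 1 / 2 * (d * s ^ 2)) =
      (5 - d * s * r) ^ 2 / (2 * d * r ^ 2) := by
    field_simp
    ring
  have h6 : 0 ≤ (5 - d * s * r) ^ 2 / (2 * d * r ^ 2) := by positivity
  have h7 : 1 / r * s = s / r := by ring
  have h8 : s / 2 / r = s / r / 2 := by ring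
  rw [h7] at h2
  rw [h8] at h4
  linarith

theorem sum_eq_diag_add {n m : ℕ} (V : PBM n m) (j : Fin m) (f : Fin n → ℝ) :
    ∑ i, f i = f (Fin.castLE V.le j) + ∑ i with i ≠ Fin.castLE V.le j, f i := by
  rw [← Finset.add_sum_erase _ _ (Finset.mem_univ (Fin.castLE V.le j)), Finset.filter_ne']

/-- The self-bounding step. In each column the diagonal entry is eliminated by means of
`1 - x j j = ∑_{i ≠ j} x i j`; the remaining entries are compared with the regret. -/
theorem two_roundBound_sub_le {n m t : ℕ} (V : PBM n m) (ht : 1 ≤ t)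
    {x : Matrix (Fin n) (Fin m) ℝ} (hx : x ∈ convexHull ℝ (actionSet n m)) :
    2 * roundBound t x - dot (x - V.best) V.meanLoss ≤
      (25 / 2 * (1 / (t : ℝ)) + 2 * (rateStep t - rateStep (t + 1))) * V.invGapSum +
        4 * m * (1 / (t : ℝ)) := by
  have ht0 : (1 : ℝ) ≤ t := by exact_mod_cast ht
  have hr : 0 < √(t : ℝ) := Real.sqrt_pos.2 (by linarith)
  have htt := Real.sq_sqrt (zero_le_one.trans ht0)
  have hq := one_div_sqrt_le_rateStep ht
  have hq' := rateStep_succ_le ht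
  have hself := V.half_sum_gap_le hx
  have hround : roundBound t x = ∑ j, (∑ i, (√(x i j) * (1 - x i j) / √(t : ℝ) +
      rateStep t * √(x i j)) - rateStep t) + 2 * m / t := by
    simp only [roundBound, tsallis, Finset.sum_add_distrib, Finset.sum_sub_distrib,
      Finset.sum_neg_distrib, ← Finset.mul_sum, Finset.sum_const, Finset.card_univ,
      Fintype.card_fin, nsmul_eq_mul]
    rw [Finset.sum_comm (f := fun i j => √(x i j))]
    ring
  have hcol : ∀ j : Fin m, 2 * (∑ i, (√(x i j) * (1 - x i j) / √(t : ℝ) +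
      rateStep t * √(x i j)) - rateStep t) - 1 / 2 * ∑ i, V.gap i j * x i j ≤
      (25 / 2 * (1 / (t : ℝ)) + 2 * (rateStep t - rateStep (t + 1))) *
        ∑ i with i ≠ Fin.castLE V.le j, 1 / V.gap i j := by
    intro j
    set d := Fin.castLE V.le j
    have hone := colSum_of_mem_hull hx j
    rw [V.sum_eq_diag_add j] at hone
    have hgd : 0 ≤ V.gap d j * x d j := mul_nonneg (V.gap_nonneg _ _) (nonneg_of_mem_hull hx _ _)
    rw [V.sum_eq_diag_add j, V.sum_eq_diag_add j (fun i => V.gap i j * x i j)]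
    have hdiag := diagonal_bound (Real.sqrt_nonneg (x d j))
      (Real.sqrt_le_one.2 (le_one_of_mem_hull hx d j)) hr hq
    rw [Real.sq_sqrt (nonneg_of_mem_hull hx d j)] at hdiag
    have hent := Finset.sum_le_sum fun (i : Fin n)
      (hi : i ∈ Finset.univ.filter fun i => i ≠ d) =>
        entry_bound (nonneg_of_mem_hull hx i j) (le_one_of_mem_hull hx i j) hr hq'
          (hq'.trans hq) (V.gap_pos (Finset.mem_filter.1 hi).2) (V.gap_le_one i j)
    rw [htt] at hent
    simp only [Finset.sum_sub_distrib, Finset.sum_add_distrib, ← Finset.mul_sum,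
      ← Finset.sum_div] at hent hone hdiag ⊢
    have h1 : 1 - x d j = ∑ i with i ≠ d, x i j := by linarith
    rw [h1] at hdiag ⊢
    linarith
  have hsum := Finset.sum_le_sum fun j (_ : j ∈ Finset.univ) => hcol j
  rw [← Finset.mul_sum, Finset.sum_sub_distrib, ← Finset.mul_sum, ← Finset.mul_sum] at hsum
  have h4 : 2 * (2 * (m : ℝ) / t) = 4 * m * (1 / (t : ℝ)) := by ring
  rw [hround, invGapSum]
  linarith

/-! ### Summation over the rounds -/

theorem sum_one_div_le (T : ℕ) : ∑ t ∈ Finset.Icc 1 T, 1 / (t : ℝ) ≤ 1 + Real.log T := by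
  have h := harmonic_le_one_add_log T
  rw [harmonic_eq_sum_Icc] at h
  push_cast at h
  simpa [one_div] using h

theorem rateStep_nonneg (t : ℕ) : 0 ≤ rateStep t := by
  have : √((t : ℝ) - 1) ≤ √(t : ℝ) := Real.sqrt_le_sqrt (by linarith)
  rw [rateStep]
  linarith

theorem sum_rateStep_sub_le (T : ℕ) :
    ∑ t ∈ Finset.Icc 1 T, (rateStep t - rateStep (t + 1)) ≤ 2 := by
  have h : ∑ t ∈ Finset.Icc 1 T, (rateStep t - rateStep (t + 1)) = 2 - rateStep (T + 1) := by
    induction T with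
    | zero => simp [rateStep]
    | succ T ih => rw [Finset.sum_Icc_succ_top (by omega), ih]; ring
  rw [h]
  linarith [rateStep_nonneg (T + 1)]

theorem invGapSum_nonneg {n m : ℕ} (V : PBM n m) : 0 ≤ V.invGapSum :=
  Finset.sum_nonneg fun _ _ => Finset.sum_nonneg fun _ _ =>
    one_div_nonneg.2 (V.gap_nonneg _ _)

theorem dot_sub_best_le_card {n m : ℕ} (V : PBM n m) {x : Matrix (Fin n) (Fin m) ℝ}
    (hx : x ∈ convexHull ℝ (actionSet n m)) : dot (x - V.best) V.meanLoss ≤ m := by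
  refine (V.dot_sub_best_le hx).trans ?_
  have : ∀ j ∈ (Finset.univ : Finset (Fin m)),
      ∑ i with i ≠ Fin.castLE V.le j, x i j ≤ 1 := fun j _ => by
    have h1 := colSum_of_mem_hull hx j
    rw [V.sum_eq_diag_add j] at h1
    linarith [nonneg_of_mem_hull hx (Fin.castLE V.le j) j]
  simpa using Finset.sum_le_sum this

theorem dot_sub_best_le_invGapSum {n m : ℕ} (V : PBM n m) {x : Matrix (Fin n) (Fin m) ℝ}
    (hx : x ∈ convexHull ℝ (actionSet n m)) :
    dot (x - V.best) V.meanLoss ≤ V.invGapSum := by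
  refine (V.dot_sub_best_le hx).trans
    (Finset.sum_le_sum fun j _ => Finset.sum_le_sum fun i hi => ?_)
  exact (le_one_of_mem_hull hx i j).trans
    ((one_le_div (V.gap_pos (Finset.mem_filter.1 hi).2)).2 (V.gap_le_one i j))

/-- `∑ⱼ ∑_{i ≠ j} 1 / Δᵢⱼ ≤ m n / (Δ_β Δ)`, term by term. -/
theorem invGapSum_le {n m : ℕ} (V : PBM n m) (hn : 2 ≤ n) :
    0 < V.gapBeta ∧ V.gapBeta ≤ 1 ∧ 0 < V.gapAlpha ∧ V.gapAlpha ≤ 1 ∧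
      V.invGapSum ≤ m * n / (V.gapBeta * V.gapAlpha) := by
  have hm := V.one_le
  have hnb : Nonempty (Fin m) := ⟨⟨0, hm⟩⟩
  have hna : Nonempty {i : Fin m // (i : ℕ) + 1 < n} := ⟨⟨⟨0, hm⟩, hn⟩⟩
  have hb : ∀ k : ℕ, k < m → V.gapBeta ≤ V.betaExt k - V.betaExt (k + 1) := fun k hk =>
    ciInf_le (Set.finite_range fun j : Fin m => V.betaExt j - V.betaExt (j + 1)).bddBelow ⟨k, hk⟩
  have ha : ∀ i k : Fin n, i < k → (i : ℕ) < m → V.gapAlpha ≤ V.α i - V.α k := by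
    intro i k hik him
    have hk : (i : ℕ) + 1 < n := lt_of_le_of_lt hik k.2
    refine (ciInf_le (Set.finite_range fun i : {i : Fin m // (i : ℕ) + 1 < n} =>
      V.α (Fin.castLE V.le i.1) - V.α ⟨(i.1 : ℕ) + 1, i.2⟩).bddBelow ⟨⟨i, him⟩, hk⟩).trans ?_
    exact sub_le_sub_left (V.alpha_anti (Fin.le_def.2 (Nat.succ_le_of_lt hik))) _
  have hbpos : 0 < V.gapBeta := by
    obtain ⟨j, hj⟩ := exists_eq_ciInf_of_finite (f := fun j : Fin m =>
      V.betaExt j - V.betaExt (j + 1))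
    rw [gapBeta, ← hj]
    exact sub_pos.2 (V.betaExt_succ_lt j.2)
  have hapos : 0 < V.gapAlpha := by
    obtain ⟨i, hi⟩ := exists_eq_ciInf_of_finite (f := fun i : {i : Fin m // (i : ℕ) + 1 < n} =>
      V.α (Fin.castLE V.le i.1) - V.α ⟨(i.1 : ℕ) + 1, i.2⟩)
    rw [gapAlpha, ← hi]
    exact sub_pos.2 (V.alpha_lt _ _ (Fin.lt_def.2 (Nat.lt_succ_self _)) i.1.2)
  have hb1 : V.gapBeta ≤ 1 := by
    linarith [hb 0 hm, V.betaExt_le_one 0, V.betaExt_nonneg (0 + 1)]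
  have ha1 : V.gapAlpha ≤ 1 := by
    have := ha ⟨0, by omega⟩ ⟨1, by omega⟩ (Fin.lt_def.2 one_pos) hm
    linarith [V.alpha_le_one ⟨0, by omega⟩, V.alpha_nonneg ⟨1, by omega⟩]
  refine ⟨hbpos, hb1, hapos, ha1, ?_⟩
  have hgap : ∀ (i : Fin n) (j : Fin m), i ≠ Fin.castLE V.le j →
      V.gapBeta * V.gapAlpha ≤ V.gap i j := by
    intro i j hij
    have hne : (i : ℕ) ≠ j := fun h => hij (Fin.ext h)
    unfold gap
    split_ifs with h1 h2
    · have h3 := hb j j.2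
      exact mul_le_mul h3 (ha _ _ (Fin.lt_def.2 h1) j.2) hapos.le (hbpos.le.trans h3)
    · exact absurd h2.symm hne
    · have hlt : (i : ℕ) < j := by omega
      have h3 := hb (j - 1) (by omega)
      rw [Nat.sub_add_cancel (by omega)] at h3
      exact mul_le_mul h3 (ha _ _ (Fin.lt_def.2 hlt) (hlt.trans j.2)) hapos.le (hbpos.le.trans h3)
  have hprod : 0 < V.gapBeta * V.gapAlpha := mul_pos hbpos hapos
  have hterm : V.invGapSum ≤ ∑ _j : Fin m, ∑ _i : Fin n, 1 / (V.gapBeta * V.gapAlpha) := by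
    refine Finset.sum_le_sum fun j _ => ?_
    refine (Finset.sum_le_sum fun i hi =>
      one_div_le_one_div_of_le hprod (hgap i j (Finset.mem_filter.1 hi).2)).trans ?_
    exact Finset.sum_le_sum_of_subset_of_nonneg (Finset.filter_subset _ _) fun _ _ _ => by
      positivity
  refine hterm.trans (le_of_eq ?_)
  simp
  ring

section Run

variable {n m : ℕ} {V : PBM n m} {P : Matrix (Fin n) (Fin m) ℝ → PMF (Fin m ↪ Fin n)} {T : ℕ}
  {Ω : Type*} [MeasurableSpace Ω] {μ : Measure Ω} [IsProbabilityMeasure μ]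
  {ell : ℕ → Ω → Fin n → Fin m → Bool} {I : ℕ → Ω → Fin m ↪ Fin n}

/-- The self-bounding argument: writing the regret as twice itself minus itself and bounding the
first copy by stability and penalty. -/
theorem IsRun.regret_best_le_log (h : IsRun V P T μ ell I) (hP : IsSamplingRule P) :
    regret μ ell I T V.best ≤
      (25 / 2 * (1 + Real.log T) + 4) * V.invGapSum + 4 * m * (1 + Real.log T) := by
  have h1 := h.regret_best_le hP
  have h2 := h.regret_eq hP V.best
  have h3 : ∑ t ∈ Finset.Icc 1 T, (2 * ∫ ω, roundBound t (leaderAt ell I t ω) ∂μ -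
      ∫ ω, dot (leaderAt ell I t ω - V.best) V.meanLoss ∂μ) ≤
      ∑ t ∈ Finset.Icc 1 T, ((25 / 2 * (1 / (t : ℝ)) + 2 * (rateStep t - rateStep (t + 1))) *
        V.invGapSum + 4 * m * (1 / (t : ℝ))) := by
    refine Finset.sum_le_sum fun t ht => ?_
    have hi1 := (h.integrable_leaderAt ht (roundBound t)).const_mul 2
    have hi2 := h.integrable_leaderAt ht fun x => dot (x - V.best) V.meanLoss
    rw [← integral_const_mul, ← integral_sub hi1 hi2]
    refine (integral_mono (hi1.sub hi2) (integrable_const _) fun ω =>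
      V.two_roundBound_sub_le (Finset.mem_Icc.1 ht).1 (leaderAt_mem_hull V ell I t ω)).trans ?_
    simp
  rw [Finset.sum_sub_distrib, ← Finset.mul_sum, ← h2, Finset.sum_add_distrib, ← Finset.sum_mul,
    Finset.sum_add_distrib, ← Finset.mul_sum, ← Finset.mul_sum, ← Finset.mul_sum] at h3
  have h4 := sum_one_div_le T
  have h5 := sum_rateStep_sub_le T
  have h6 : (25 / 2 * ∑ t ∈ Finset.Icc 1 T, 1 / (t : ℝ) +
      2 * ∑ t ∈ Finset.Icc 1 T, (rateStep t - rateStep (t + 1))) * V.invGapSum ≤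
      (25 / 2 * (1 + Real.log T) + 4) * V.invGapSum :=
    mul_le_mul_of_nonneg_right (by linarith) V.invGapSum_nonneg
  have h7 : 4 * (m : ℝ) * ∑ t ∈ Finset.Icc 1 T, 1 / (t : ℝ) ≤ 4 * m * (1 + Real.log T) :=
    mul_le_mul_of_nonneg_left h4 (by positivity)
  linarith

theorem IsRun.regret_best_le_mul (h : IsRun V P T μ ell I) (hP : IsSamplingRule P) {c : ℝ}
    (hc : ∀ x ∈ convexHull ℝ (actionSet n m), dot (x - V.best) V.meanLoss ≤ c) :
    regret μ ell I T V.best ≤ T * c := by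
  rw [h.regret_eq hP]
  have : ∀ t ∈ Finset.Icc 1 T,
      ∫ ω, dot (leaderAt ell I t ω - V.best) V.meanLoss ∂μ ≤ c := fun t ht => by
    refine (integral_mono (h.integrable_leaderAt ht fun x => dot (x - V.best) V.meanLoss)
      (integrable_const c) fun ω => hc _ (leaderAt_mem_hull V ell I t ω)).trans ?_
    simp
  simpa using Finset.sum_le_sum this

/-- For `T ≥ 21` the logarithm is large enough to absorb the constants of the self-bounding
argument. For smaller `T` it suffices that the regret per round is at most `m` and at most
`∑ⱼ ∑_{i ≠ j} 1 / Δᵢⱼ`. -/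
theorem IsRun.regret_best_le_main (h : IsRun V P T μ ell I) (hP : IsSamplingRule P)
    (hT : 1 ≤ T) :
    regret μ ell I T V.best ≤ (18 * V.invGapSum + 4 * m) * Real.log T + 6 * m := by
  have hD := V.invGapSum_nonneg
  have hm : (0 : ℝ) ≤ m := Nat.cast_nonneg m
  have hlog0 : 0 ≤ Real.log T := Real.log_nonneg (by exact_mod_cast hT)
  have hR1 := h.regret_best_le_mul hP fun x hx => V.dot_sub_best_le_card hx
  have hR2 := h.regret_best_le_mul hP fun x hx => V.dot_sub_best_le_invGapSum hx
  have hDl : 0 ≤ V.invGapSum * Real.log T := mul_nonneg hD hlog0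
  have hml : 0 ≤ (m : ℝ) * Real.log T := mul_nonneg hm hlog0
  have hT0 : (0 : ℝ) < T := by exact_mod_cast hT
  rcases le_or_gt T 6 with h6 | h6
  · have hT6 : (T : ℝ) ≤ 6 := by exact_mod_cast h6
    have := mul_le_mul_of_nonneg_right hT6 hm
    linarith
  rcases le_or_gt T 18 with h18 | h18
  · have hT7 : (7 : ℝ) ≤ T := by exact_mod_cast h6
    have hT18 : (T : ℝ) ≤ 18 := by exact_mod_cast h18
    have hlog : 1 ≤ Real.log T := by
      rw [Real.le_log_iff_exp_le hT0]
      linarith [Real.exp_one_lt_d9]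
    have h1 := mul_le_mul_of_nonneg_right hT18 hD
    have h2 := mul_le_mul_of_nonneg_left hlog hD
    linarith
  have hT19 : (19 : ℝ) ≤ T := by exact_mod_cast h18
  rcases le_or_gt T 20 with h20 | h20
  · have hT20 : (T : ℝ) ≤ 20 := by exact_mod_cast h20
    have hlog : 2 ≤ Real.log T := by
      rw [Real.le_log_iff_exp_le hT0, show (2 : ℝ) = 1 + 1 by norm_num, Real.exp_add]
      nlinarith [Real.exp_one_lt_d9, Real.exp_pos 1]
    have h1 := mul_le_mul_of_nonneg_right hT20 hD
    have h2 := mul_le_mul_of_nonneg_left hlog hD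
    linarith
  have hT21 : (21 : ℝ) ≤ T := by exact_mod_cast h20
  have hlog : 3 ≤ Real.log T := by
    rw [Real.le_log_iff_exp_le hT0, show (3 : ℝ) = (3 : ℕ) * 1 by norm_num, Real.exp_nat_mul]
    refine le_trans ?_ hT21
    have := pow_le_pow_left₀ (Real.exp_pos 1).le Real.exp_one_lt_d9.le 3
    refine this.trans ?_
    norm_num
  have hR := h.regret_best_le_log hP
  have h2 := mul_le_mul_of_nonneg_left hlog hD
  linarith

end Run

theorem logBound_le {n m T : ℕ} (V : PBM n m) (hn : 2 ≤ n) (hT : 2 ≤ T) :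
    (18 * V.invGapSum + 4 * m) * Real.log T + 6 * m ≤
      34 * (m * n / (V.gapBeta * V.gapAlpha) * Real.log T) := by
  obtain ⟨hb0, hb1, ha0, ha1, hD⟩ := V.invGapSum_le hn
  set Q := m * n / (V.gapBeta * V.gapAlpha)
  have hmQ : (m : ℝ) ≤ Q := by
    rw [le_div_iff₀ (mul_pos hb0 ha0)]
    have h1 : V.gapBeta * V.gapAlpha ≤ n :=
      (mul_le_one₀ hb1 ha0.le ha1).trans (by exact_mod_cast (by omega : 1 ≤ n))
    exact mul_le_mul_of_nonneg_left h1 (Nat.cast_nonneg m)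
  have hlog : 1 / 2 ≤ Real.log T := by
    have h1 := Real.log_two_gt_d9
    have h2 := Real.log_le_log two_pos (by exact_mod_cast hT : (2 : ℝ) ≤ T)
    linarith
  have hm : (0 : ℝ) ≤ m := Nat.cast_nonneg m
  have h1 := mul_le_mul_of_nonneg_right (by linarith : 18 * V.invGapSum + 4 * m ≤ 22 * Q)
    (by linarith : 0 ≤ Real.log T)
  have h2 := mul_le_mul_of_nonneg_left hlog (hm.trans hmQ)
  linarith

end

end PBM

theorem theorem2 :
    ∃ C : ℝ, 0 < C ∧ ∀ (n m : ℕ) (V : PBM n m) (T : ℕ), 1 ≤ T →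
      (∀ (P : Matrix (Fin n) (Fin m) ℝ → PMF (Fin m ↪ Fin n)), PBM.IsSamplingRule P →
        ∀ (Ω : Type*) [MeasurableSpace Ω] (μ : Measure Ω) [IsProbabilityMeasure μ]
          (ell : ℕ → Ω → Fin n → Fin m → Bool) (I : ℕ → Ω → Fin m ↪ Fin n),
          PBM.IsRun V P T μ ell I →
          ∀ xstar : Matrix (Fin n) (Fin m) ℝ, PBM.IsBestAction μ ell T xstar →
            PBM.regret μ ell I T xstar ≤
              (18 * (∑ j, ∑ i with i ≠ Fin.castLE V.le j, 1 / V.gap i j) + 4 * m) *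
                Real.log T + 6 * m) ∧
      (2 ≤ n → 2 ≤ T →
        (18 * (∑ j, ∑ i with i ≠ Fin.castLE V.le j, 1 / V.gap i j) + 4 * m) *
            Real.log T + 6 * m ≤
          C * (m * n / (V.gapBeta * V.gapAlpha) * Real.log T)) := by
  refine ⟨34, by norm_num, fun n m V T hT => ⟨?_, fun hn hT2 => V.logBound_le hn hT2⟩⟩
  intro P hP Ω _ μ _ ell I hrun xstar hbest
  exact (hrun.regret_le_regret_best hP (subset_convexHull ℝ _ hbest.1)).trans
    (hrun.regret_best_le_main hP hT)
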